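/- Let $A\in\mathbb Z^{m\times n}$ with $\operatorname{rank}A=m$, $n\ge 1$, $b\in\mathbb Z^m$, $c\in\mathbb Z^n$, and consider the linear optimization problem $(A,b,c)$: $\min c^Tx$ s.t. $Ax=b$, $x\ge 0$, with dual $\max b^Ty$ s.t. $A^Ty+s=c$, $s\ge 0$. Let $$L=mn+m+n+\sum_{i,j}\lceil\log_2(|a_{ij}|+1)\rceil+\sum_j\lceil\log_2(|c_j|+1)\rceil+\sum_i\lceil\log_2(|b_i|+1)\rceil .$$ Let $\mathcal{PD}^*$ be the set of all $(x,y,s)$ with $Ax=b$, $A^Ty+s=c$, $x,s\ge0$, $x^Ts=0$, and let $\mathcal B=\{j: x^*_j>0\text{ for some }(x^*,y^*,s^*)\in\mathcal{PD}^*\}$, $\mathcal N=\{j: s^*_j>0\text{ for some }(x^*,y^*,s^*)\in\mathcal{PD}^*\}$. For $s>0$, $\mu>0$ and $S=\operatorname{diag}(s)$, the exact Newton direction $(\Delta\hat s,\Delta y)$ at $(s,\mu)$ is the unique solution of $$\begin{bmatrix}S^2&A^T\\A&0\end{bmatrix}\begin{bmatrix}\Delta\hat s\\ \Delta y\end{bmatrix}=\begin{bmatrix}0\\-\frac1\mu\,(b-\mu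 AS^{-1}e)\end{bmatrix},$$ and $\Delta s=S^2\Delta\hat s$, $\delta(s,\mu)=\|S^{-1}\Delta s\|_2$, $x(s,\mu)=\mu S^{-1}(e-S^{-1}\Delta s)$. Algorithm (almost-exact dual logarithmic barrier method; input $y^0,s^0,\mu^0,\theta,t$). While $\mu^k>2^{-2L}$: compute any $(\Delta\hat s^k,\Delta y^k)$ that solves the Newton system at $(s^k,\mu^k)$ with precision $2^{-tL}$, i.e. the Euclidean distance to the exact solution is at most $2^{-tL}$, where in each iteration the distance may be measured either in the variables $(\Delta\hat s,\Delta y)$ or in the variables $(\Delta s,\Delta y)$; put $y^{k+1}=y^k+\Delta y^k$, $s^{k+1}=s^k+(S^k)^2\Delta\hat s^k$, $\mu^{k+1}=(1-\theta)\mu^k$. Let $\xi^{k+1}=(S^k)^2\Delta\hat s^k+A^T\Delta y^k$ be the resulting error in the dual equation and $r^k=\sum_{i=1}^k\xi^i$. Theorem. For every constant $\kappa\ge1$ there is a constant $C>0$ depending only on $\kappa$ such that the following holds for all real $t\ge 3\kappa+6$ (e.g. $t=9$ for $\kappa=1$) and all $A,b,c$ as above. Suppose that $A^Ty^0+s^0=c$,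 $2^{-\kappa L}\le s^0_i\le 2^{\kappa L}$ for all $i$, $0<\mu^0\le 2^{\kappa L}$, $\delta(s^0,\mu^0)<\frac12$, and $\frac1{4\kappa\sqrt n}\le\theta\le\frac1{4\sqrt n}$. Then for every run of the algorithm, whatever the errors within the stated precision: 1. The number of iterations is at most $C\sqrt n\,L$. 2. For every iterate $k$: the Newton system at $s^k$ is nonsingular, $\delta(s^k,\mu^k)<\frac12$, the triple $(x(s^k,\mu^k),y^k,s^k)$ is strictly feasible for the perturbed problem $(A,b,c+r^k)$, i.e. $Ax(s^k,\mu^k)=b$, $A^Ty^k+s^k=c+r^k$, $x(s^k,\mu^k)>0$, $s^k>0$, and $\|r^k\|_2\le 2^{(3\kappa+2-t)L}$. 3. At termination, after $K$ iterations, put $\tilde x=x(s^K,\mu^K)$. Then $\tilde x^Ts^K/n\le\frac32\,2^{-2L}$; rounding entries below $2^{-L}$ to zero identifies the optimal partition of $(A,b,c)$: $\{i:s^K_i<2^{-L}\}=\mathcal B$ and $\{i:\tilde x_i<2^{-L}\}=\mathcal N$; and solving the least squares problems $$\min\{\|x-\tilde x\|_2: Ax=b,\ x_i=0\text{ whenever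 }\tilde x_i<2^{-L}\},$$ $$\min\{\|s-s^K\|_2: A^Ty+s=c,\ s_i=0\text{ whenever }s^K_i<2^{-L}\}$$ yields an exact optimal solution of the original problem: both have solutions, and all solutions $x$ and $(y,s)$ satisfy $(x,y,s)\in\mathcal{PD}^*$. -/

import Mathlib

open Matrix

/-- The Euclidean norm of a real vector. -/
noncomputable def l2norm {ι : Type*} [Fintype ι] (v : ι → ℝ) : ℝ :=
  ‖(WithLp.toLp 2 v : EuclideanSpace ℝ ι)‖

/-- A linear optimization problem in standard form,
`min cᵀx` subject to `A x = b`, `x ≥ 0`, with the dual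
`max bᵀy` subject to `Aᵀy + s = c`, `s ≥ 0`. -/
structure LO (m n : ℕ) where
  A : Matrix (Fin m) (Fin n) ℝ
  b : Fin m → ℝ
  c : Fin n → ℝ

namespace LO

variable {m n : ℕ}

/-- Primal-dual feasible solutions `(x, y, s)`. -/
def feasibleSet (P : LO m n) : Set ((Fin n → ℝ) × (Fin m → ℝ) × (Fin n → ℝ)) :=
  {p | P.A *ᵥ p.1 = P.b ∧ P.Aᵀ *ᵥ p.2.1 + p.2.2 = P.c ∧ 0 ≤ p.1 ∧ 0 ≤ p.2.2}

/-- Strictly feasible (interior) primal-dual solutions. -/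
def interiorSet (P : LO m n) : Set ((Fin n → ℝ) × (Fin m → ℝ) × (Fin n → ℝ)) :=
  {p | p ∈ P.feasibleSet ∧ (∀ i, 0 < p.1 i) ∧ ∀ i, 0 < p.2.2 i}

/-- Primal-dual optimal solutions: feasible and complementary. -/
def optimalSet (P : LO m n) : Set ((Fin n → ℝ) × (Fin m → ℝ) × (Fin n → ℝ)) :=
  {p | p ∈ P.feasibleSet ∧ p.1 ⬝ᵥ p.2.2 = 0}

/-- `ζ`-optimal solutions: feasible with `xᵀs / n ≤ ζ`. -/
def approxOptimalSet (P : LO m n) (ζ : ℝ) :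
    Set ((Fin n → ℝ) × (Fin m → ℝ) × (Fin n → ℝ)) :=
  {p | p ∈ P.feasibleSet ∧ p.1 ⬝ᵥ p.2.2 / n ≤ ζ}

/-- The part `B` of the optimal partition. -/
def partitionB (P : LO m n) : Set (Fin n) := {j | ∃ p ∈ P.optimalSet, 0 < p.1 j}

/-- The part `N` of the optimal partition. -/
def partitionN (P : LO m n) : Set (Fin n) := {j | ∃ p ∈ P.optimalSet, 0 < p.2.2 j}

/-- The perturbed problem `(A, b, c + r)`. -/
def perturb (P : LO m n) (r : Fin n → ℝ) : LO m n := ⟨P.A, P.b, P.c + r⟩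

/-- The coefficient matrix `[S², Aᵀ; A, 0]` of the Newton system in the unknowns `(Δŝ, Δy)`. -/
def newtonMatrix (P : LO m n) (s : Fin n → ℝ) :
    Matrix (Fin n ⊕ Fin m) (Fin n ⊕ Fin m) ℝ :=
  Matrix.fromBlocks (Matrix.diagonal fun i => s i ^ 2) P.Aᵀ P.A 0

/-- The right-hand side `(0, -(1/μ)(b - μ A S⁻¹ e))` of the Newton system. -/
noncomputable def newtonRhs (P : LO m n) (s : Fin n → ℝ) (μ : ℝ) : Fin n ⊕ Fin m → ℝ :=
  Sum.elim 0 (-((1 / μ) • (P.b - μ • (P.A *ᵥ fun i => (s i)⁻¹))))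

/-- The Newton system is nonsingular at every positive `s`. -/
theorem isUnit_det_newtonMatrix (P : LO m n) (hA : P.A.rank = m) {s : Fin n → ℝ}
    (hs : ∀ i, 0 < s i) : IsUnit (P.newtonMatrix s).det := by
  rw [isUnit_iff_ne_zero]
  intro h0
  obtain ⟨z, hz, hMz⟩ := Matrix.exists_mulVec_eq_zero_iff.mpr h0
  obtain ⟨u, v, rfl⟩ : ∃ u v, z = Sum.elim u v := ⟨_, _, (Sum.elim_comp_inl_inr z).symm⟩
  rw [newtonMatrix, Matrix.fromBlocks_mulVec] at hMz
  simp only [Sum.elim_comp_inl, Sum.elim_comp_inr, Matrix.zero_mulVec, add_zero] at hMz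
  have h1 : ∀ i, s i ^ 2 * u i + (P.Aᵀ *ᵥ v) i = 0 := fun i => by
    have := congrFun hMz (Sum.inl i)
    simpa [Matrix.mulVec_diagonal] using this
  have h2 : P.A *ᵥ u = 0 := by
    funext j
    simpa using congrFun hMz (Sum.inr j)
  have h3 : ∑ i, s i ^ 2 * u i ^ 2 = 0 := by
    have h4 : u ⬝ᵥ (P.Aᵀ *ᵥ v) = 0 := by
      rw [Matrix.dotProduct_mulVec, Matrix.vecMul_transpose, h2, zero_dotProduct]
    have h5 : ∑ i, (s i ^ 2 * u i ^ 2 + u i * (P.Aᵀ *ᵥ v) i) = 0 :=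
      Finset.sum_eq_zero fun i _ => by linear_combination u i * h1 i
    rw [Finset.sum_add_distrib] at h5
    rw [dotProduct] at h4
    linarith
  have hu : u = 0 := by
    funext i
    have := (Finset.sum_eq_zero_iff_of_nonneg (fun i _ => by positivity)).mp h3 i (Finset.mem_univ i)
    have hsi := (hs i).ne'
    simpa [hsi] using this
  have hv : P.Aᵀ *ᵥ v = 0 := by
    funext i
    simpa [hu] using h1 i
  have hli : LinearIndependent ℝ P.A.row := by
    rw [linearIndependent_iff_card_eq_finrank_span, Set.finrank, ← Matrix.rank_eq_finrank_span_row, hA,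
      Fintype.card_fin]
  have hv0 : v = 0 := by
    rw [Matrix.mulVec_transpose] at hv
    exact Matrix.vecMul_injective_iff.mpr hli (hv.trans (Matrix.zero_vecMul _).symm)
  apply hz
  funext i
  cases i <;> simp [hu, hv0]

/-- The exact solution `(Δŝ, Δy)` of the Newton system. -/
noncomputable def newtonSol (P : LO m n) (s : Fin n → ℝ) (μ : ℝ) : Fin n ⊕ Fin m → ℝ :=
  (P.newtonMatrix s)⁻¹ *ᵥ P.newtonRhs s μ

/-- The component `Δŝ` of the exact Newton direction. -/
noncomputable def newtonDsHat (P : LO m n) (s : Fin n → ℝ) (μ : ℝ) : Fin n → ℝ :=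
  fun i => P.newtonSol s μ (Sum.inl i)

/-- The component `Δy` of the exact Newton direction. -/
noncomputable def newtonDy (P : LO m n) (s : Fin n → ℝ) (μ : ℝ) : Fin m → ℝ :=
  fun j => P.newtonSol s μ (Sum.inr j)

/-- The exact Newton direction `Δs = S² Δŝ` in the slack variables. -/
noncomputable def newtonDs (P : LO m n) (s : Fin n → ℝ) (μ : ℝ) : Fin n → ℝ :=
  fun i => s i ^ 2 * P.newtonDsHat s μ i

/-- The proximity measure `δ(s, μ) = ‖s⁻¹ Δs‖₂`. -/
noncomputable def proximity (P : LO m n) (s : Fin n → ℝ) (μ : ℝ) : ℝ :=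
  l2norm fun i => (s i)⁻¹ * P.newtonDs s μ i

/-- The primal vector `x = μ S⁻¹(e - S⁻¹ Δs)` that belongs to `(s, μ)`. -/
noncomputable def primalEstimate (P : LO m n) (s : Fin n → ℝ) (μ : ℝ) : Fin n → ℝ :=
  fun i => μ * ((s i)⁻¹ - P.newtonDsHat s μ i)

/-- `(u, v)` solves the Newton system for `(Δŝ, Δy)` at `(s, μ)` with precision `ε`: its Euclidean
distance to the exact solution is at most `ε`, measured either in the unknowns `(Δŝ, Δy)` of the
system or in the unscaled direction `(Δs, Δy)`, where `Δs = S² Δŝ`. -/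
def SolvesNewton (P : LO m n) (s : Fin n → ℝ) (μ ε : ℝ) (u : Fin n → ℝ) (v : Fin m → ℝ) : Prop :=
  l2norm (Sum.elim (u - P.newtonDsHat s μ) (v - P.newtonDy s μ)) ≤ ε ∨
  l2norm (Sum.elim ((fun i => s i ^ 2 * u i) - P.newtonDs s μ) (v - P.newtonDy s μ)) ≤ ε

/-- The first `K` passes through the loop
`while μ > τ: solve the Newton system for (Δŝ, Δy) with precision ε; y += Δy; s += S² Δŝ;
μ := (1 - θ) μ`.
`y k, s k, μ k` are the values before pass `k` (counted from `0`), and `(dsHat k, dy k)` is the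
direction that is computed in it. -/
structure IsExecution (P : LO m n) (τ θ ε : ℝ) (y : ℕ → Fin m → ℝ) (s : ℕ → Fin n → ℝ) (μ : ℕ → ℝ)
    (dsHat : ℕ → Fin n → ℝ) (dy : ℕ → Fin m → ℝ) (K : ℕ) : Prop where
  guard : ∀ k < K, τ < μ k
  solve : ∀ k < K, P.SolvesNewton (s k) (μ k) ε (dsHat k) (dy k)
  y_step : ∀ k < K, y (k + 1) = y k + dy k
  s_step : ∀ k < K, s (k + 1) = s k + fun i => s k i ^ 2 * dsHat k i
  mu_step : ∀ k < K, μ (k + 1) = (1 - θ) * μ k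

/-- The error `ξ` that a direction `(Δŝ, Δy)` computed at `s` leaves in the dual equation:
`ξ = S² Δŝ + Aᵀ Δy`. -/
def dualError (P : LO m n) (s dsHat : Fin n → ℝ) (dy : Fin m → ℝ) : Fin n → ℝ :=
  (fun i => s i ^ 2 * dsHat i) + P.Aᵀ *ᵥ dy

/-- The accumulated perturbation `rᵏ`, the sum of the dual errors of the first `k` passes. -/
def perturbation (P : LO m n) (s dsHat : ℕ → Fin n → ℝ) (dy : ℕ → Fin m → ℝ) (k : ℕ) :
    Fin n → ℝ :=
  ∑ j ∈ Finset.range k, P.dualError (s j) (dsHat j) (dy j)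

/-- Solutions of `A x = b` in which the entries with `x̃ᵢ < τ` are rounded to zero. -/
def roundedPrimal (P : LO m n) (τ : ℝ) (x' : Fin n → ℝ) : Set (Fin n → ℝ) :=
  {x | P.A *ᵥ x = P.b ∧ ∀ i, x' i < τ → x i = 0}

/-- Solutions of `Aᵀy + s = c` in which the entries with `s̃ᵢ < τ` are rounded to zero. -/
def roundedDual (P : LO m n) (τ : ℝ) (s' : Fin n → ℝ) : Set ((Fin m → ℝ) × (Fin n → ℝ)) :=
  {q | P.Aᵀ *ᵥ q.1 + q.2 = P.c ∧ ∀ i, s' i < τ → q.2 i = 0}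

/-- `(x, y, s)` is a result of the rounding procedure with threshold `τ` applied to `(x̃, s̃)`:
the entries below `τ` are set to zero, and `x` and `(y, s)` solve the least squares problems of
minimizing `‖x - x̃‖₂` and `‖s - s̃‖₂` under the remaining primal and dual equations. -/
def IsRounding (P : LO m n) (τ : ℝ) (x' s' : Fin n → ℝ)
    (p : (Fin n → ℝ) × (Fin m → ℝ) × (Fin n → ℝ)) : Prop :=
  (p.1 ∈ P.roundedPrimal τ x' ∧
    IsMinOn (fun x => l2norm (x - x')) (P.roundedPrimal τ x') p.1) ∧
  (p.2 ∈ P.roundedDual τ s' ∧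
    IsMinOn (fun q => l2norm (q.2 - s')) (P.roundedDual τ s') p.2)

end LO

/-- Integer input data of a linear optimization problem. -/
structure IntLO (m n : ℕ) where
  A : Matrix (Fin m) (Fin n) ℤ
  b : Fin m → ℤ
  c : Fin n → ℤ

namespace IntLO

variable {m n : ℕ}

/-- The linear optimization problem with the given integer data. -/
def toLO (I : IntLO m n) : LO m n :=
  ⟨I.A.map fun a => (a : ℝ), fun i => (I.b i : ℝ), fun j => (I.c j : ℝ)⟩

/-- The binary input length
`L = mn + m + n + ∑ ⌈log₂(|aᵢⱼ| + 1)⌉ + ∑ ⌈log₂(|cⱼ| + 1)⌉ + ∑ ⌈log₂(|bᵢ| + 1)⌉`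
(`Nat.clog 2` is the rounded-up binary logarithm). -/
def inputLength (I : IntLO m n) : ℕ :=
  m * n + m + n + ∑ i, ∑ j, Nat.clog 2 ((I.A i j).natAbs + 1)
    + ∑ j, Nat.clog 2 ((I.c j).natAbs + 1) + ∑ i, Nat.clog 2 ((I.b i).natAbs + 1)

end IntLO

/-! A full Newton step leaves `A x(s, μ) = b` intact and squares the distance to the central path,
so a shrinking of `μ` by `1 - θ` and a small relative error of the computed direction keep `δ(s, μ)
< 1 / 2`. The errors add up to a perturbation of the dual equation. As long as that perturbation is
negligible against `s⁰`, orthogonality to the starting point keeps `s` and `x(s, μ)` within a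
factor of order `n` of their initial scale and hence the next relative error small: the two bounds
sustain each other until `μ ≤ 2 ^ (-2L)`.

At the end, orthogonality to an arbitrary optimal solution bounds the gap by `7 / 4 * n * μ`, while
by Cramer's rule and integrality some optimal solution has its `i`-th primal or dual entry at least
the reciprocal of a minor of `A`. As `L` exceeds the bit length of these minors, every index lies on
its side of the threshold `2 ^ (-L)`. By Cramer's rule again, dropping the small entries can be
repaired by moving the large ones very little, so the least squares solutions stay positive where
they must be. Strict complementarity is not assumed: a strictly complementary solution is a limit of
points near the central path. -/

/-! ### The Euclidean norm -/

section EuclideanNorm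

variable {ι ι' : Type*} [Fintype ι] [Fintype ι']

theorem l2norm_sq (v : ι → ℝ) : l2norm v ^ 2 = ∑ i, v i ^ 2 := by
  simp [l2norm, EuclideanSpace.norm_sq_eq]

theorem l2norm_nonneg (v : ι → ℝ) : 0 ≤ l2norm v := norm_nonneg _

theorem l2norm_zero : l2norm (0 : ι → ℝ) = 0 := by
  simp [l2norm]

theorem l2norm_add_le (v w : ι → ℝ) : l2norm (v + w) ≤ l2norm v + l2norm w := by
  simpa [l2norm] using norm_add_le (WithLp.toLp 2 v) (WithLp.toLp 2 w)

theorem l2norm_smul (a : ℝ) (v : ι → ℝ) : l2norm (a • v) = |a| * l2norm v := by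
  simp [l2norm, norm_smul]

theorem abs_apply_le_l2norm (v : ι → ℝ) (i : ι) : |v i| ≤ l2norm v := by
  simpa [l2norm] using PiLp.norm_apply_le (WithLp.toLp 2 v) i

theorem l2norm_le_of_sum_sq_le {v : ι → ℝ} {a : ℝ} (ha : 0 ≤ a) (h : ∑ i, v i ^ 2 ≤ a ^ 2) :
    l2norm v ≤ a := by
  rw [← l2norm_sq] at h
  exact (pow_le_pow_iff_left₀ (l2norm_nonneg v) ha two_ne_zero).mp h

theorem l2norm_le_l2norm_of_abs_le {v w : ι → ℝ} (h : ∀ i, |v i| ≤ |w i|) :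
    l2norm v ≤ l2norm w := by
  refine l2norm_le_of_sum_sq_le (l2norm_nonneg w) ?_
  rw [l2norm_sq]
  exact Finset.sum_le_sum fun i _ => sq_le_sq.mpr (h i)

theorem l2norm_le_mul_of_abs_le {v w : ι → ℝ} {a : ℝ} (ha : 0 ≤ a) (h : ∀ i, |v i| ≤ a * |w i|) :
    l2norm v ≤ a * l2norm w := by
  have := l2norm_le_l2norm_of_abs_le (v := v) (w := a • w) fun i => by
    simpa [abs_mul, abs_of_nonneg ha] using h i
  rwa [l2norm_smul, abs_of_nonneg ha] at this

theorem l2norm_le_sum_abs (v : ι → ℝ) : l2norm v ≤ ∑ i, |v i| := by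
  refine l2norm_le_of_sum_sq_le (Finset.sum_nonneg fun i _ => abs_nonneg _) ?_
  have := Finset.sum_sq_le_sq_sum_of_nonneg (s := Finset.univ) (f := fun i => |v i|)
    fun i _ => abs_nonneg _
  simpa using this

theorem l2norm_le_l2norm_elim_left (v : ι → ℝ) (w : ι' → ℝ) :
    l2norm v ≤ l2norm (Sum.elim v w) := by
  refine l2norm_le_of_sum_sq_le (l2norm_nonneg _) ?_
  rw [l2norm_sq, Fintype.sum_sum_type]
  simpa using Finset.sum_nonneg fun i _ => sq_nonneg (w i)

theorem l2norm_le_l2norm_elim_right (v : ι → ℝ) (w : ι' → ℝ) :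
    l2norm w ≤ l2norm (Sum.elim v w) := by
  refine l2norm_le_of_sum_sq_le (l2norm_nonneg _) ?_
  rw [l2norm_sq, Fintype.sum_sum_type]
  simpa using Finset.sum_nonneg fun i _ => sq_nonneg (v i)

theorem l2norm_sum_le {α : Type*} (t : Finset α) (f : α → ι → ℝ) :
    l2norm (∑ j ∈ t, f j) ≤ ∑ j ∈ t, l2norm (f j) :=
  Finset.le_sum_of_subadditive l2norm l2norm_zero.le l2norm_add_le t f

theorem l2norm_mulVec_le (A : Matrix ι ι' ℝ) (v : ι' → ℝ) :
    l2norm (A *ᵥ v) ≤ (∑ i, ∑ j, |A i j|) * l2norm v := by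
  refine (l2norm_le_sum_abs _).trans ?_
  rw [Finset.sum_mul]
  refine Finset.sum_le_sum fun i _ => ?_
  rw [Finset.sum_mul]
  refine (Finset.abs_sum_le_sum_abs _ _).trans (Finset.sum_le_sum fun j _ => ?_)
  rw [abs_mul]
  gcongr
  exact abs_apply_le_l2norm v j

theorem l2norm_le_l2norm_sub_of_dotProduct_eq_zero {v w : ι → ℝ} (h : v ⬝ᵥ w = 0) :
    l2norm v ≤ l2norm (w - v) := by
  refine l2norm_le_of_sum_sq_le (l2norm_nonneg _) ?_
  have hexpand : ∑ i, (w - v) i ^ 2 = ∑ i, w i ^ 2 + ∑ i, v i ^ 2 - 2 * (v ⬝ᵥ w) := by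
    simp only [dotProduct, Finset.mul_sum, ← Finset.sum_add_distrib, ← Finset.sum_sub_distrib]
    exact Finset.sum_congr rfl fun i _ => by rw [Pi.sub_apply]; ring
  rw [l2norm_sq, hexpand, h]
  linarith [Finset.sum_nonneg fun i (_ : i ∈ Finset.univ) => sq_nonneg (w i)]

end EuclideanNorm

/-! ### Exact Newton directions -/

theorem dotProduct_transpose_mulVec_eq_zero {m n R : Type*} [Fintype m] [Fintype n]
    [CommSemiring R] {A : Matrix m n R} {z : n → R} (hz : A *ᵥ z = 0) (w : m → R) :
    z ⬝ᵥ (Aᵀ *ᵥ w) = 0 := by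
  rw [Matrix.dotProduct_mulVec, Matrix.vecMul_transpose, hz, zero_dotProduct]

namespace LO

variable {m n : ℕ} {P : LO m n} {s : Fin n → ℝ} {μ : ℝ}

theorem newtonSol_eq_elim : P.newtonSol s μ = Sum.elim (P.newtonDsHat s μ) (P.newtonDy s μ) := by
  funext i
  cases i <;> rfl

theorem newtonMatrix_mulVec_elim (hA : P.A.rank = m) (hs : ∀ i, 0 < s i) :
    P.newtonMatrix s *ᵥ Sum.elim (P.newtonDsHat s μ) (P.newtonDy s μ) = P.newtonRhs s μ := by
  rw [← newtonSol_eq_elim, newtonSol, Matrix.mulVec_mulVec,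
    Matrix.mul_nonsing_inv _ (P.isUnit_det_newtonMatrix hA hs), Matrix.one_mulVec]

theorem newtonDs_eq_transpose_mulVec (hA : P.A.rank = m) (hs : ∀ i, 0 < s i) :
    P.newtonDs s μ = P.Aᵀ *ᵥ (-P.newtonDy s μ) := by
  have h := newtonMatrix_mulVec_elim (μ := μ) hA hs
  rw [newtonMatrix, Matrix.fromBlocks_mulVec] at h
  funext i
  have := congrFun h (Sum.inl i)
  simp only [newtonRhs, Sum.elim_inl, Sum.elim_comp_inl, Sum.elim_comp_inr, Pi.add_apply,
    Matrix.mulVec_diagonal, Pi.zero_apply] at this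
  rw [Matrix.mulVec_neg, Pi.neg_apply, newtonDs]
  linarith

theorem mulVec_newtonDsHat (hA : P.A.rank = m) (hs : ∀ i, 0 < s i) :
    P.A *ᵥ P.newtonDsHat s μ = -((1 / μ) • (P.b - μ • (P.A *ᵥ fun i => (s i)⁻¹))) := by
  have h := newtonMatrix_mulVec_elim (μ := μ) hA hs
  rw [newtonMatrix, Matrix.fromBlocks_mulVec] at h
  funext i
  simpa [newtonRhs] using congrFun h (Sum.inr i)

theorem mulVec_primalEstimate (hA : P.A.rank = m) (hs : ∀ i, 0 < s i) (hμ : μ ≠ 0) :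
    P.A *ᵥ P.primalEstimate s μ = P.b := by
  have hx : P.primalEstimate s μ = μ • ((fun i => (s i)⁻¹) - P.newtonDsHat s μ) := rfl
  rw [hx, Matrix.mulVec_smul, Matrix.mulVec_sub, mulVec_newtonDsHat hA hs]
  funext i
  simp only [Pi.smul_apply, Pi.sub_apply, Pi.neg_apply, smul_eq_mul]
  field_simp
  ring

theorem primalEstimate_mul {i : Fin n} (hi : s i ≠ 0) :
    P.primalEstimate s μ i * s i = μ * (1 - (s i)⁻¹ * P.newtonDs s μ i) := by
  rw [primalEstimate, newtonDs]
  field_simp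

theorem abs_inv_mul_newtonDs_le_proximity (i : Fin n) :
    |(s i)⁻¹ * P.newtonDs s μ i| ≤ P.proximity s μ :=
  abs_apply_le_l2norm (fun i => (s i)⁻¹ * P.newtonDs s μ i) i

theorem dotProduct_sub_primalEstimate (hA : P.A.rank = m) (hs : ∀ i, 0 < s i) (hμ : μ ≠ 0)
    {x : Fin n → ℝ} (hx : P.A *ᵥ x = P.b) :
    (fun i => (s i)⁻¹ * P.newtonDs s μ i) ⬝ᵥ
      (fun i => (x i - P.primalEstimate s μ i) * s i / μ) = 0 := by
  have hker : P.A *ᵥ (x - P.primalEstimate s μ) = 0 := by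
    rw [Matrix.mulVec_sub, hx, mulVec_primalEstimate hA hs hμ, sub_self]
  have horth := dotProduct_transpose_mulVec_eq_zero hker (-P.newtonDy s μ)
  rw [← newtonDs_eq_transpose_mulVec hA hs] at horth
  calc _ = μ⁻¹ * ((x - P.primalEstimate s μ) ⬝ᵥ P.newtonDs s μ) := by
        rw [dotProduct, dotProduct, Finset.mul_sum]
        refine Finset.sum_congr rfl fun i _ => ?_
        have := (hs i).ne'
        rw [Pi.sub_apply]
        field_simp
    _ = 0 := by rw [horth, mul_zero]

/-- Among all solutions of `A x = b`, the primal estimate comes closest to `x s = μ e`. -/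
theorem proximity_le (hA : P.A.rank = m) (hs : ∀ i, 0 < s i) (hμ : μ ≠ 0) {x : Fin n → ℝ}
    (hx : P.A *ᵥ x = P.b) : P.proximity s μ ≤ l2norm fun i => x i * s i / μ - 1 := by
  refine (l2norm_le_l2norm_sub_of_dotProduct_eq_zero
    (dotProduct_sub_primalEstimate hA hs hμ hx)).trans_eq (congrArg l2norm (funext fun i => ?_))
  rw [Pi.sub_apply, sub_mul, primalEstimate_mul (hs i).ne', sub_div, mul_div_cancel_left₀ _ hμ]
  ring

/-- The pair `(s, μ)` lies in the neighbourhood `δ(s, μ) < 1/2` of the central path, in which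
Newton steps converge quadratically. -/
structure IsCentered (P : LO m n) (s : Fin n → ℝ) (μ : ℝ) : Prop where
  pos : ∀ i, 0 < s i
  mu_pos : 0 < μ
  proximity_lt : P.proximity s μ < 1 / 2

namespace IsCentered

theorem abs_inv_mul_newtonDs_lt (h : P.IsCentered s μ) (i : Fin n) :
    |(s i)⁻¹ * P.newtonDs s μ i| < 1 / 2 :=
  (abs_inv_mul_newtonDs_le_proximity i).trans_lt h.proximity_lt

theorem half_mu_lt (h : P.IsCentered s μ) (i : Fin n) :
    μ / 2 < P.primalEstimate s μ i * s i := by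
  rw [primalEstimate_mul (h.pos i).ne']
  nlinarith [(abs_lt.mp (h.abs_inv_mul_newtonDs_lt i)).2, h.mu_pos]

theorem primalEstimate_mul_lt (h : P.IsCentered s μ) (i : Fin n) :
    P.primalEstimate s μ i * s i < 3 / 2 * μ := by
  rw [primalEstimate_mul (h.pos i).ne']
  nlinarith [(abs_lt.mp (h.abs_inv_mul_newtonDs_lt i)).1, h.mu_pos]

theorem primalEstimate_pos (h : P.IsCentered s μ) (i : Fin n) : 0 < P.primalEstimate s μ i :=
  pos_of_mul_pos_left ((half_pos h.mu_pos).trans (h.half_mu_lt i)) (h.pos i).le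

end IsCentered

theorem l2norm_one_sub_sq_div_sub_one_le {ι : Type*} [Fintype ι] {θ : ℝ} {q : ι → ℝ}
    (hθ : 0 ≤ θ) (hθ4 : θ ≤ 1 / 4) (hθn : θ ^ 2 * Fintype.card ι ≤ 1 / 16)
    (hq : l2norm q < 1 / 2) : l2norm (fun i => (1 - q i ^ 2) / (1 - θ) - 1) ≤ 3 / 8 := by
  have hq2 : ∑ i, q i ^ 2 ≤ 1 / 4 := by
    rw [← l2norm_sq]
    nlinarith [l2norm_nonneg q]
  have hq0 : 0 ≤ ∑ i, q i ^ 2 := Finset.sum_nonneg fun i _ => sq_nonneg _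
  have hq4 : ∑ i, (q i ^ 2) ^ 2 ≤ (∑ i, q i ^ 2) ^ 2 :=
    Finset.sum_sq_le_sq_sum_of_nonneg fun i _ => sq_nonneg _
  refine l2norm_le_of_sum_sq_le (by norm_num) ?_
  have hsum : ∑ i, ((1 - q i ^ 2) / (1 - θ) - 1) ^ 2 =
      (θ ^ 2 * Fintype.card ι - 2 * θ * ∑ i, q i ^ 2 + ∑ i, (q i ^ 2) ^ 2) / (1 - θ) ^ 2 := by
    rw [Finset.mul_sum, mul_comm (θ ^ 2), ← nsmul_eq_mul, ← Finset.card_univ, ← Finset.sum_const,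
      ← Finset.sum_sub_distrib, ← Finset.sum_add_distrib, Finset.sum_div]
    refine Finset.sum_congr rfl fun i _ => ?_
    have : 1 - θ ≠ 0 := by linarith
    field_simp
    ring
  rw [hsum, div_le_iff₀ (by nlinarith)]
  have hquad : (∑ i, q i ^ 2) ^ 2 ≤ (∑ i, q i ^ 2) / 4 := by nlinarith
  nlinarith [mul_nonneg hθ (sub_nonneg.mpr hq2), sq_nonneg θ, mul_nonneg hθ hq0]

/-- With `q = S⁻¹Δs` and `f` the relative error of the computed direction, a full step turns the
products `x s = μ (e - q)` into `μ (e - q) (e + q + f)`, whose exact part is `μ (e - q²)`. -/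
theorem l2norm_one_sub_mul_div_sub_one_lt {ι : Type*} [Fintype ι] {θ : ℝ} {q f : ι → ℝ}
    (hθ : 0 ≤ θ) (hθ4 : θ ≤ 1 / 4) (hθn : θ ^ 2 * Fintype.card ι ≤ 1 / 16)
    (hq : l2norm q < 1 / 2) (hf : l2norm f ≤ 1 / 17) :
    l2norm (fun i => (1 - q i) * (1 + q i + f i) / (1 - θ) - 1) < 1 / 2 := by
  have h1θ : 0 < 1 - θ := by linarith
  have hsplit : (fun i => (1 - q i) * (1 + q i + f i) / (1 - θ) - 1)
      = (fun i => (1 - q i ^ 2) / (1 - θ) - 1) + fun i => (1 - q i) * f i / (1 - θ) := by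
    funext i
    rw [Pi.add_apply]
    ring
  have herror : l2norm (fun i => (1 - q i) * f i / (1 - θ)) ≤ 2 * l2norm f := by
    refine l2norm_le_mul_of_abs_le zero_le_two fun i => ?_
    have hqi := abs_lt.mp ((abs_apply_le_l2norm q i).trans_lt hq)
    have : |1 - q i| ≤ 3 / 2 := abs_le.mpr ⟨by linarith, by linarith⟩
    rw [abs_div, abs_mul, abs_of_pos h1θ, div_le_iff₀ h1θ]
    nlinarith [abs_nonneg (f i)]
  rw [hsplit]
  linarith [l2norm_add_le (fun i => (1 - q i ^ 2) / (1 - θ) - 1)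
    fun i => (1 - q i) * f i / (1 - θ), l2norm_one_sub_sq_div_sub_one_le hθ hθ4 hθn hq]

theorem IsCentered.newton_step (h : P.IsCentered s μ) (hA : P.A.rank = m) {θ : ℝ} (hθ : 0 ≤ θ)
    (hθ4 : θ ≤ 1 / 4) (hθn : θ ^ 2 * n ≤ 1 / 16) {e : Fin n → ℝ}
    (he : l2norm (fun i => (s i)⁻¹ * e i) ≤ 1 / 17) :
    P.IsCentered (s + P.newtonDs s μ + e) ((1 - θ) * μ) := by
  set q : Fin n → ℝ := fun i => (s i)⁻¹ * P.newtonDs s μ i with hq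
  set f : Fin n → ℝ := fun i => (s i)⁻¹ * e i with hf
  have hnew : ∀ i, (s + P.newtonDs s μ + e) i = s i * (1 + q i + f i) := fun i => by
    have := (h.pos i).ne'
    simp only [hq, hf, Pi.add_apply]
    field_simp
  have hpos : ∀ i, 0 < (s + P.newtonDs s μ + e) i := fun i => by
    rw [hnew]
    exact mul_pos (h.pos i) (by linarith [(abs_lt.mp (h.abs_inv_mul_newtonDs_lt i)).1,
      (abs_le.mp ((abs_apply_le_l2norm f i).trans he)).1])
  have hμ' : 0 < (1 - θ) * μ := mul_pos (by linarith) h.mu_pos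
  refine ⟨hpos, hμ', (proximity_le hA hpos hμ'.ne'
    (mulVec_primalEstimate (μ := μ) hA h.pos h.mu_pos.ne')).trans_lt ?_⟩
  have hproduct : (fun i => P.primalEstimate s μ i * (s + P.newtonDs s μ + e) i / ((1 - θ) * μ) - 1)
      = fun i => (1 - q i) * (1 + q i + f i) / (1 - θ) - 1 := by
    funext i
    rw [hnew, ← mul_assoc, primalEstimate_mul (h.pos i).ne', mul_assoc μ, mul_comm (1 - θ),
      mul_div_mul_left _ _ h.mu_pos.ne']
  rw [hproduct]
  exact l2norm_one_sub_mul_div_sub_one_lt hθ hθ4 (by simpa using hθn) h.proximity_lt he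

end LO

/-! ### Bounds relative to a centered starting point -/

namespace LO

variable {m n : ℕ} {P : LO m n} {s₀ s ρ : Fin n → ℝ} {w : Fin m → ℝ} {μ₀ μ : ℝ}

/-- Since `x - x₀` lies in the kernel of `A`, it is orthogonal to `s - s₀ - ρ`; this bounds the
mixed products `x s₀` and `x₀ s` by the products `x₀ s₀` and `x s`. -/
theorem IsCentered.add_mixed_products_le (h₀ : P.IsCentered s₀ μ₀) (hA : P.A.rank = m)
    {x : Fin n → ℝ} (hAx : P.A *ᵥ x = P.b) (hx : 0 ≤ x) (hs : 0 ≤ s)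
    (hxs : ∀ i, x i * s i ≤ 3 / 2 * μ₀) (hdual : s = s₀ + ρ + P.Aᵀ *ᵥ w)
    (hρ : ∀ i, |ρ i| ≤ s₀ i / 10) (i : Fin n) :
    9 / 10 * (x i * s₀ i) + P.primalEstimate s₀ μ₀ i * s i ≤ n * (63 / 20 * μ₀) := by
  set x₀ := P.primalEstimate s₀ μ₀
  have hx₀ : ∀ j, 0 < x₀ j := h₀.primalEstimate_pos
  have horth : ∑ j, (x j - x₀ j) * (s j - s₀ j - ρ j) = 0 := by
    have hker : P.A *ᵥ (x - x₀) = 0 := by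
      rw [Matrix.mulVec_sub, hAx, mulVec_primalEstimate hA h₀.pos h₀.mu_pos.ne', sub_self]
    rw [← dotProduct_transpose_mulVec_eq_zero hker w, dotProduct]
    refine Finset.sum_congr rfl fun j _ => ?_
    rw [hdual]
    simp only [Pi.add_apply, Pi.sub_apply]
    ring
  have hterm : ∀ j, 9 / 10 * (x j * s₀ j) + x₀ j * s j
      + (x j - x₀ j) * (s j - s₀ j - ρ j) ≤ 63 / 20 * μ₀ := fun j => by
    have hρj := abs_le.mp (hρ j)
    nlinarith [hxs j, h₀.primalEstimate_mul_lt j, mul_le_mul_of_nonneg_left hρj.1 (hx j),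
      mul_le_mul_of_nonneg_left hρj.2 (hx₀ j).le]
  calc 9 / 10 * (x i * s₀ i) + x₀ i * s i
      ≤ ∑ j, (9 / 10 * (x j * s₀ j) + x₀ j * s j) :=
        Finset.single_le_sum (f := fun j => 9 / 10 * (x j * s₀ j) + x₀ j * s j)
          (fun j _ => add_nonneg (mul_nonneg (by norm_num) (mul_nonneg (hx j) (h₀.pos j).le))
            (mul_nonneg (hx₀ j).le (hs j))) (Finset.mem_univ i)
    _ = ∑ j, (9 / 10 * (x j * s₀ j) + x₀ j * s j + (x j - x₀ j) * (s j - s₀ j - ρ j)) := by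
        rw [Finset.sum_add_distrib (g := fun j => (x j - x₀ j) * (s j - s₀ j - ρ j)), horth,
          add_zero]
    _ ≤ n * (63 / 20 * μ₀) := by
        simpa using Finset.sum_le_card_nsmul Finset.univ _ _ fun j _ => hterm j

theorem IsCentered.le_and_mul_le_seven_mul (h₀ : P.IsCentered s₀ μ₀) (hA : P.A.rank = m)
    {x : Fin n → ℝ} (hAx : P.A *ᵥ x = P.b) (hx : 0 ≤ x) (hs : 0 ≤ s)
    (hxs : ∀ i, x i * s i ≤ 3 / 2 * μ₀) (hdual : s = s₀ + ρ + P.Aᵀ *ᵥ w)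
    (hρ : ∀ i, |ρ i| ≤ s₀ i / 10) (i : Fin n) :
    s i ≤ 7 * n * s₀ i ∧ x i * s₀ i ≤ 7 * n * μ₀ := by
  have hsum := h₀.add_mixed_products_le hA hAx hx hs hxs hdual hρ i
  have hx₀s : 0 ≤ P.primalEstimate s₀ μ₀ i * s i := mul_nonneg (h₀.primalEstimate_pos i).le (hs i)
  have hxs₀ : 0 ≤ x i * s₀ i := mul_nonneg (hx i) (h₀.pos i).le
  have hnμ₀ : 0 ≤ n * μ₀ := mul_nonneg n.cast_nonneg h₀.mu_pos.le
  refine ⟨le_of_mul_le_mul_left ?_ (half_pos h₀.mu_pos), by linarith⟩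
  calc μ₀ / 2 * s i ≤ P.primalEstimate s₀ μ₀ i * s₀ i * s i :=
        mul_le_mul_of_nonneg_right (h₀.half_mu_lt i).le (hs i)
    _ = P.primalEstimate s₀ μ₀ i * s i * s₀ i := by ring
    _ ≤ n * (63 / 20 * μ₀) * s₀ i := mul_le_mul_of_nonneg_right (by linarith) (h₀.pos i).le
    _ ≤ μ₀ / 2 * (7 * n * s₀ i) := by linarith [mul_nonneg hnμ₀ (h₀.pos i).le]

theorem transpose_mulVec_eq_zero_of_rows_eq_zero (P : LO 0 n) (w : Fin 0 → ℝ) :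
    P.Aᵀ *ᵥ w = 0 := by
  funext i
  simp [Matrix.mulVec, dotProduct]

theorem IsCentered.primalEstimate_mul_eq_of_rows_eq_zero {P : LO 0 n} (h : P.IsCentered s μ)
    (hA : P.A.rank = 0) (i : Fin n) : P.primalEstimate s μ i * s i = μ := by
  rw [primalEstimate_mul (h.pos i).ne', newtonDs_eq_transpose_mulVec hA h.pos,
    transpose_mulVec_eq_zero_of_rows_eq_zero]
  simp

/-- A factor by which the iterates can exceed the starting point. Without equality constraints the
slacks change only by the errors of the Newton steps, and the input length may be too short there
to absorb the factor `7 n` of the general case. -/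
noncomputable def growthFactor (m n : ℕ) : ℝ := if m = 0 then 6 / 5 else 7 * n

theorem one_le_growthFactor (hn : 0 < n) : 1 ≤ growthFactor m n := by
  have hn1 : (1 : ℝ) ≤ n := by exact_mod_cast hn
  unfold growthFactor
  split_ifs <;> linarith

section Iterate

variable (h₀ : P.IsCentered s₀ μ₀) (h : P.IsCentered s μ) (hA : P.A.rank = m) (hμ : μ ≤ μ₀)
  (hdual : s = s₀ + ρ + P.Aᵀ *ᵥ w) (hρ : ∀ i, |ρ i| ≤ s₀ i / 10)

include h₀ h hA hμ hdual hρ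

theorem IsCentered.le_growthFactor_mul (i : Fin n) : s i ≤ growthFactor m n * s₀ i := by
  obtain rfl | hm := Nat.eq_zero_or_pos m
  · have hsi : s i = s₀ i + ρ i := by
      rw [hdual, transpose_mulVec_eq_zero_of_rows_eq_zero, add_zero, Pi.add_apply]
    rw [growthFactor, if_pos rfl, hsi]
    linarith [(abs_le.mp (hρ i)).2, h₀.pos i]
  · rw [growthFactor, if_neg hm.ne']
    exact (h₀.le_and_mul_le_seven_mul hA (mulVec_primalEstimate hA h.pos h.mu_pos.ne')
      (fun j => (h.primalEstimate_pos j).le) (fun j => (h.pos j).le)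
      (fun j => (h.primalEstimate_mul_lt j).le.trans (by linarith)) hdual hρ i).1

theorem IsCentered.primalEstimate_mul_le_growthFactor_mul (i : Fin n) :
    P.primalEstimate s μ i * s₀ i ≤ growthFactor m n * μ₀ := by
  obtain rfl | hm := Nat.eq_zero_or_pos m
  · have hsi : s i = s₀ i + ρ i := by
      rw [hdual, transpose_mulVec_eq_zero_of_rows_eq_zero, add_zero, Pi.add_apply]
    have hprod : P.primalEstimate s μ i * s i = μ := h.primalEstimate_mul_eq_of_rows_eq_zero hA i
    have hle : P.primalEstimate s μ i * (9 / 10 * s₀ i) ≤ P.primalEstimate s μ i * s i :=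
      mul_le_mul_of_nonneg_left (by linarith [(abs_le.mp (hρ i)).1]) (h.primalEstimate_pos i).le
    rw [growthFactor, if_pos rfl]
    linarith [h.mu_pos]
  · rw [growthFactor, if_neg hm.ne']
    exact (h₀.le_and_mul_le_seven_mul hA (mulVec_primalEstimate hA h.pos h.mu_pos.ne')
      (fun j => (h.primalEstimate_pos j).le) (fun j => (h.pos j).le)
      (fun j => (h.primalEstimate_mul_lt j).le.trans (by linarith)) hdual hρ i).2

end Iterate

theorem mul_eq_zero_of_mem_optimalSet {p : (Fin n → ℝ) × (Fin m → ℝ) × (Fin n → ℝ)}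
    (hp : p ∈ P.optimalSet) (i : Fin n) : p.1 i * p.2.2 i = 0 :=
  (Finset.sum_eq_zero_iff_of_nonneg fun i _ => mul_nonneg (hp.1.2.2.1 i) (hp.1.2.2.2 i)).mp
    hp.2 i (Finset.mem_univ i)

theorem IsCentered.optimal_mul_le_growthFactor_mul (h₀ : P.IsCentered s₀ μ₀) (hA : P.A.rank = m)
    {y₀ : Fin m → ℝ} (hdual : P.Aᵀ *ᵥ y₀ + s₀ = P.c)
    {p : (Fin n → ℝ) × (Fin m → ℝ) × (Fin n → ℝ)} (hp : p ∈ P.optimalSet) (i : Fin n) :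
    p.1 i * s₀ i ≤ growthFactor m n * μ₀ := by
  obtain ⟨hpx, hpd, hpx0, hps0⟩ := hp.1
  have hslack : p.2.2 = s₀ + 0 + P.Aᵀ *ᵥ (y₀ - p.2.1) := by
    rw [Matrix.mulVec_sub, eq_sub_of_add_eq' hpd, ← hdual]
    abel
  have hμ₀ := h₀.mu_pos
  obtain rfl | hm := Nat.eq_zero_or_pos m
  · have hps : p.2.2 i = s₀ i := by
      rw [hslack, transpose_mulVec_eq_zero_of_rows_eq_zero, add_zero, add_zero]
    rw [← hps, mul_eq_zero_of_mem_optimalSet hp, growthFactor, if_pos rfl]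
    positivity
  · rw [growthFactor, if_neg hm.ne']
    exact (h₀.le_and_mul_le_seven_mul hA hpx hpx0 hps0
      (fun j => by rw [mul_eq_zero_of_mem_optimalSet hp]; positivity) hslack
      (fun j => by simpa using div_nonneg (h₀.pos j).le (by norm_num)) i).2

end LO

/-! ### Inexact Newton steps -/

namespace LO

variable {m n : ℕ} {P : LO m n}

/-- The deviation of the slack step `S² Δŝ` computed at `(s, μ)` from the exact Newton step. -/
noncomputable def stepError (P : LO m n) (s : Fin n → ℝ) (μ : ℝ) (dsHat : Fin n → ℝ) :
    Fin n → ℝ :=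
  (fun i => s i ^ 2 * dsHat i) - P.newtonDs s μ

theorem stepError_apply (P : LO m n) (s : Fin n → ℝ) (μ : ℝ) (u : Fin n → ℝ) (i : Fin n) :
    P.stepError s μ u i = s i ^ 2 * (u - P.newtonDsHat s μ) i := by
  simp only [stepError, newtonDs, Pi.sub_apply]
  ring

namespace SolvesNewton

variable {s u : Fin n → ℝ} {v : Fin m → ℝ} {μ ε : ℝ}

theorem nonneg (h : P.SolvesNewton s μ ε u v) : 0 ≤ ε :=
  h.elim (l2norm_nonneg _).trans (l2norm_nonneg _).trans

theorem l2norm_sub_newtonDy_le (h : P.SolvesNewton s μ ε u v) :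
    l2norm (v - P.newtonDy s μ) ≤ ε :=
  h.elim (l2norm_le_l2norm_elim_right _ _).trans (l2norm_le_l2norm_elim_right _ _).trans

theorem l2norm_sub_newtonDsHat_le_or_stepError_le (h : P.SolvesNewton s μ ε u v) :
    l2norm (u - P.newtonDsHat s μ) ≤ ε ∨ l2norm (P.stepError s μ u) ≤ ε :=
  h.imp (l2norm_le_l2norm_elim_left _ _).trans (l2norm_le_l2norm_elim_left _ _).trans

theorem abs_stepError_le (h : P.SolvesNewton s μ ε u v) (i : Fin n) :
    |P.stepError s μ u i| ≤ (s i ^ 2 + 1) * ε := by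
  have hε := h.nonneg
  rcases h.l2norm_sub_newtonDsHat_le_or_stepError_le with hu | hu
  · have := (abs_apply_le_l2norm _ i).trans hu
    rw [stepError_apply, abs_mul, abs_of_nonneg (sq_nonneg _)]
    nlinarith [sq_nonneg (s i)]
  · have := (abs_apply_le_l2norm _ i).trans hu
    nlinarith [sq_nonneg (s i)]

theorem l2norm_stepError_le (h : P.SolvesNewton s μ ε u v) {a : ℝ} (ha : 1 ≤ a)
    (hs : ∀ i, |s i| ≤ a) : l2norm (P.stepError s μ u) ≤ a ^ 2 * ε := by
  rcases h.l2norm_sub_newtonDsHat_le_or_stepError_le with hu | hu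
  · refine (l2norm_le_mul_of_abs_le (sq_nonneg a) fun i => ?_).trans
      (mul_le_mul_of_nonneg_left hu (sq_nonneg a))
    rw [stepError_apply, abs_mul, abs_pow]
    gcongr
    exact hs i
  · exact hu.trans (le_mul_of_one_le_left h.nonneg (one_le_pow₀ ha))

theorem l2norm_inv_mul_stepError_le (h : P.SolvesNewton s μ ε u v) (hs : ∀ i, 0 < s i) {a : ℝ}
    (hsa : ∀ i, s i ≤ a) (hsa' : ∀ i, (s i)⁻¹ ≤ a) (ha : 0 ≤ a) :
    l2norm (fun i => (s i)⁻¹ * P.stepError s μ u i) ≤ a * ε := by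
  rcases h.l2norm_sub_newtonDsHat_le_or_stepError_le with hu | hu
  · refine (l2norm_le_mul_of_abs_le ha fun i => ?_).trans (mul_le_mul_of_nonneg_left hu ha)
    rw [stepError_apply, sq, ← mul_assoc, inv_mul_cancel_left₀ (hs i).ne', abs_mul,
      abs_of_pos (hs i)]
    gcongr
    exact hsa i
  · refine (l2norm_le_mul_of_abs_le ha fun i => ?_).trans (mul_le_mul_of_nonneg_left hu ha)
    rw [abs_mul, abs_of_pos (inv_pos.mpr (hs i))]
    gcongr
    exact hsa' i

end SolvesNewton

/-- The sum of the slack step errors in the first `k` passes. -/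
noncomputable def slackError (P : LO m n) (s : ℕ → Fin n → ℝ) (μ : ℕ → ℝ)
    (dsHat : ℕ → Fin n → ℝ) (k : ℕ) : Fin n → ℝ :=
  ∑ j ∈ Finset.range k, P.stepError (s j) (μ j) (dsHat j)

theorem slackError_succ (s : ℕ → Fin n → ℝ) (μ : ℕ → ℝ) (dsHat : ℕ → Fin n → ℝ) (k : ℕ) :
    P.slackError s μ dsHat (k + 1)
      = P.slackError s μ dsHat k + P.stepError (s k) (μ k) (dsHat k) :=
  Finset.sum_range_succ _ _

theorem dualError_eq (hA : P.A.rank = m) {s : Fin n → ℝ} (hs : ∀ i, 0 < s i) (μ : ℝ)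
    (dsHat : Fin n → ℝ) (dy : Fin m → ℝ) :
    P.dualError s dsHat dy = P.stepError s μ dsHat + P.Aᵀ *ᵥ (dy - P.newtonDy s μ) := by
  rw [dualError, stepError, newtonDs_eq_transpose_mulVec hA hs, Matrix.mulVec_neg,
    Matrix.mulVec_sub]
  abel

namespace IsExecution

variable {τ θ ε : ℝ} {y : ℕ → Fin m → ℝ} {s : ℕ → Fin n → ℝ} {μ : ℕ → ℝ}
  {dsHat : ℕ → Fin n → ℝ} {dy : ℕ → Fin m → ℝ} {K k : ℕ}

theorem mu_eq (h : P.IsExecution τ θ ε y s μ dsHat dy K) (hk : k ≤ K) :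
    μ k = (1 - θ) ^ k * μ 0 := by
  induction k with
  | zero => rw [pow_zero, one_mul]
  | succ k ih => rw [h.mu_step k hk, ih (by omega), pow_succ']; ring

theorem dual_feasible (h : P.IsExecution τ θ ε y s μ dsHat dy K) (h0 : P.Aᵀ *ᵥ y 0 + s 0 = P.c)
    (hk : k ≤ K) : P.Aᵀ *ᵥ y k + s k = P.c + P.perturbation s dsHat dy k := by
  induction k with
  | zero => simpa [perturbation] using h0
  | succ k ih =>
    rw [perturbation, Finset.sum_range_succ, ← perturbation, h.y_step k hk, h.s_step k hk,
      dualError, Matrix.mulVec_add, ← add_assoc P.c, ← ih (by omega)]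
    abel

theorem s_step_eq (h : P.IsExecution τ θ ε y s μ dsHat dy K) (hk : k < K) :
    s (k + 1) = s k + P.newtonDs (s k) (μ k) + P.stepError (s k) (μ k) (dsHat k) := by
  rw [h.s_step k hk, stepError]
  abel

theorem s_eq (h : P.IsExecution τ θ ε y s μ dsHat dy K) (hA : P.A.rank = m) (hk : k ≤ K)
    (hs : ∀ j < k, ∀ i, 0 < s j i) :
    s k = s 0 + P.slackError s μ dsHat k
      + P.Aᵀ *ᵥ (-∑ j ∈ Finset.range k, P.newtonDy (s j) (μ j)) := by
  induction k with
  | zero => simp [slackError]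
  | succ k ih =>
    rw [h.s_step_eq hk, slackError_succ, Finset.sum_range_succ, neg_add, Matrix.mulVec_add,
      ← newtonDs_eq_transpose_mulVec hA (hs k k.lt_succ_self)]
    nth_rw 1 [ih (by omega) fun j hj => hs j (by omega)]
    abel

end IsExecution

end LO

/-! ### Short-step runs with small errors -/

namespace LO

variable {m n : ℕ} {P : LO m n}

theorem dotProduct_sub_eq_zero {x x' s s' : Fin n → ℝ} {y y' : Fin m → ℝ} {c : Fin n → ℝ}
    (hx : P.A *ᵥ x = P.b) (hx' : P.A *ᵥ x' = P.b) (hs : P.Aᵀ *ᵥ y + s = c)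
    (hs' : P.Aᵀ *ᵥ y' + s' = c) : (x - x') ⬝ᵥ (s - s') = 0 := by
  have hker : P.A *ᵥ (x - x') = 0 := by rw [Matrix.mulVec_sub, hx, hx', sub_self]
  have hslack : s - s' = P.Aᵀ *ᵥ (y' - y) := by
    rw [Matrix.mulVec_sub, eq_sub_of_add_eq' hs, eq_sub_of_add_eq' hs']
    abel
  rw [hslack, dotProduct_transpose_mulVec_eq_zero hker]

theorem optimality_gap_le {x s ρ : Fin n → ℝ} {y : Fin m → ℝ} {μ : ℝ} (hAx : P.A *ᵥ x = P.b)
    (hdual : P.Aᵀ *ᵥ y + s = P.c + ρ) (hx : 0 ≤ x) (hxs : ∀ i, x i * s i ≤ 3 / 2 * μ)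
    (hxρ : ∀ i, x i * |ρ i| ≤ μ / 8) {p : (Fin n → ℝ) × (Fin m → ℝ) × (Fin n → ℝ)}
    (hp : p ∈ P.optimalSet) (hpρ : ∀ i, p.1 i * |ρ i| ≤ μ / 8) :
    ∑ i, (x i * p.2.2 i + p.1 i * s i) ≤ 7 / 4 * n * μ := by
  have horth : ∑ i, (x i - p.1 i) * ((s - ρ) i - p.2.2 i) = 0 :=
    dotProduct_sub_eq_zero hAx hp.1.1 (y := y)
      (by rw [← add_sub_assoc, hdual, add_sub_cancel_right]) hp.1.2.1
  have hterm : ∀ i, x i * p.2.2 i + p.1 i * s i + (x i - p.1 i) * ((s - ρ) i - p.2.2 i)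
      ≤ 7 / 4 * μ := fun i => by
    rw [Pi.sub_apply]
    nlinarith [mul_eq_zero_of_mem_optimalSet hp i, hxs i, hxρ i, hpρ i,
      mul_le_mul_of_nonneg_left (neg_abs_le (ρ i)) (hx i),
      mul_le_mul_of_nonneg_left (le_abs_self (ρ i)) (hp.1.2.2.1 i)]
  calc ∑ i, (x i * p.2.2 i + p.1 i * s i)
      = ∑ i, (x i * p.2.2 i + p.1 i * s i + (x i - p.1 i) * ((s - ρ) i - p.2.2 i)) := by
        rw [Finset.sum_add_distrib (g := fun i => (x i - p.1 i) * ((s - ρ) i - p.2.2 i)), horth,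
          add_zero]
    _ ≤ n • (7 / 4 * μ) := by
        simpa using Finset.sum_le_card_nsmul Finset.univ _ _ fun i _ => hterm i
    _ = 7 / 4 * n * μ := by rw [nsmul_eq_mul]; ring

/-- An execution of the algorithm with stopping threshold `Λ⁻²`, a centered start of size at most
`H`, a step `θ` short enough for the Newton steps to keep up, and a precision `ε` so high that the
errors of all `K` passes together stay negligible. The theorem uses `Λ = 2 ^ L`, `H = 2 ^ (κ L)` and
`ε = 2 ^ (-t L)`. -/
structure IsShortStepRun (P : LO m n) (Λ H θ ε : ℝ) (y : ℕ → Fin m → ℝ) (s : ℕ → Fin n → ℝ)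
    (μ : ℕ → ℝ) (dsHat : ℕ → Fin n → ℝ) (dy : ℕ → Fin m → ℝ) (K : ℕ) : Prop
    extends P.IsExecution (Λ ^ 2)⁻¹ θ ε y s μ dsHat dy K where
  n_pos : 0 < n
  rank_eq : P.A.rank = m
  dual_start : P.Aᵀ *ᵥ y 0 + s 0 = P.c
  centered_start : P.IsCentered (s 0) (μ 0)
  inv_le_start : ∀ i, H⁻¹ ≤ s 0 i
  start_le : ∀ i, s 0 i ≤ H
  mu_start_le : μ 0 ≤ H
  theta_nonneg : 0 ≤ θ
  theta_mul_sqrt_le : θ * √n ≤ 1 / 4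
  four_le : 4 ≤ Λ
  le_bound : Λ ≤ H
  eps_nonneg : 0 ≤ ε
  eps_mul_le : ε * (H ^ 3 * Λ ^ 6) ≤ 1
  sum_abs_le : ∑ i, ∑ j, |P.A i j| ≤ H ^ 2
  passes_mul_le : K * (growthFactor m n ^ 2 + 1) ≤ H * Λ ^ 2
  growthFactor_le : 13 * growthFactor m n ≤ Λ ^ 2

namespace IsShortStepRun

variable {Λ H θ ε : ℝ} {y : ℕ → Fin m → ℝ} {s : ℕ → Fin n → ℝ} {μ : ℕ → ℝ}
  {dsHat : ℕ → Fin n → ℝ} {dy : ℕ → Fin m → ℝ} {K k : ℕ}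

section Parameters

variable (h : P.IsShortStepRun Λ H θ ε y s μ dsHat dy K)

include h

theorem one_le_sqrt : 1 ≤ √(n : ℝ) := Real.one_le_sqrt.mpr (by exact_mod_cast h.n_pos)

theorem theta_le : θ ≤ 1 / 4 :=
  (le_mul_of_one_le_right h.theta_nonneg h.one_le_sqrt).trans h.theta_mul_sqrt_le

theorem theta_sq_mul_le : θ ^ 2 * n ≤ 1 / 16 := by
  have hsq : (θ * √n) ^ 2 ≤ (1 / 4) ^ 2 :=
    pow_le_pow_left₀ (mul_nonneg h.theta_nonneg (Real.sqrt_nonneg _)) h.theta_mul_sqrt_le 2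
  rw [mul_pow, Real.sq_sqrt n.cast_nonneg] at hsq
  linarith

theorem Λ_pos : 0 < Λ := by linarith [h.four_le]

theorem H_pos : 0 < H := h.Λ_pos.trans_le h.le_bound

theorem four_pow_le (a : ℕ) : 4 ^ a ≤ Λ ^ a := pow_le_pow_left₀ (by norm_num) h.four_le a

theorem one_le_start_mul (i : Fin n) : 1 ≤ s 0 i * H := by
  have := h.inv_le_start i
  rwa [inv_le_iff_one_le_mul₀ h.H_pos] at this

theorem mu_pos (hk : k ≤ K) : 0 < μ k := by
  rw [h.mu_eq hk]
  exact mul_pos (pow_pos (by linarith [h.theta_le]) k) h.centered_start.mu_pos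

theorem mu_le_mu_zero (hk : k ≤ K) : μ k ≤ μ 0 := by
  rw [h.mu_eq hk]
  exact mul_le_of_le_one_left h.centered_start.mu_pos.le
    (pow_le_one₀ (by linarith [h.theta_le]) (by linarith [h.theta_nonneg]))

end Parameters

theorem accumulated_error_le (h : P.IsShortStepRun Λ H θ ε y s μ dsHat dy K) (hk : k ≤ K)
    (i : Fin n) :
    k * ((growthFactor m n ^ 2 * s 0 i ^ 2 + 1) * ε) ≤ s 0 i / (H * Λ ^ 4) := by
  set β := growthFactor m n
  have hε := h.eps_nonneg
  have hΛ := h.Λ_pos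
  have hH := h.H_pos
  have hs := h.centered_start.pos i
  have hkK : (k : ℝ) ≤ K := by exact_mod_cast hk
  have hone : 1 ≤ s 0 i * H := h.one_le_start_mul i
  have hsq : β ^ 2 * s 0 i ^ 2 ≤ β ^ 2 * (s 0 i * H) := by
    rw [sq (s 0 i)]
    gcongr
    exact h.start_le i
  calc k * ((β ^ 2 * s 0 i ^ 2 + 1) * ε) ≤ K * ((s 0 i * H * (β ^ 2 + 1)) * ε) := by
        gcongr
        linarith
    _ = K * (β ^ 2 + 1) * (s 0 i * H * ε) := by ring
    _ ≤ H * Λ ^ 2 * (s 0 i * H * ε) := mul_le_mul_of_nonneg_right h.passes_mul_le (by positivity)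
    _ = ε * (H ^ 3 * Λ ^ 6) * (s 0 i / (H * Λ ^ 4)) := by field_simp
    _ ≤ s 0 i / (H * Λ ^ 4) := mul_le_of_le_one_left (by positivity) h.eps_mul_le

theorem accumulated_error_le_div_ten (h : P.IsShortStepRun Λ H θ ε y s μ dsHat dy K) (hk : k ≤ K)
    (i : Fin n) : k * ((growthFactor m n ^ 2 * s 0 i ^ 2 + 1) * ε) ≤ s 0 i / 10 := by
  refine (h.accumulated_error_le hk i).trans ?_
  have hs := h.centered_start.pos i
  gcongr
  nlinarith [h.four_le, h.le_bound, h.four_pow_le 4]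

section BeforeCentering

variable (h : P.IsShortStepRun Λ H θ ε y s μ dsHat dy K) (hk : k ≤ K)

include h hk

theorem abs_slackError_le_of_centered (hc : ∀ j < k, P.IsCentered (s j) (μ j)) (i : Fin n) :
    |P.slackError s μ dsHat k i| ≤ k * ((growthFactor m n ^ 2 * s 0 i ^ 2 + 1) * ε) := by
  induction k generalizing i with
  | zero => simp [slackError]
  | succ k ih =>
    have hρ := ih (by omega) fun j hj => hc j (by omega)
    have hck := hc k k.lt_succ_self
    have hle : s k i ≤ growthFactor m n * s 0 i :=
      h.centered_start.le_growthFactor_mul hck h.rank_eq (h.mu_le_mu_zero (by omega))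
        (h.s_eq h.rank_eq (by omega) fun j hj => (hc j (by omega)).pos)
        (fun i => (hρ i).trans (h.accumulated_error_le_div_ten (by omega) i)) i
    rw [slackError_succ, Pi.add_apply]
    push_cast
    rw [add_mul, one_mul]
    refine (abs_add_le _ _).trans (add_le_add (hρ i) (((h.solve k hk).abs_stepError_le i).trans ?_))
    rw [← mul_pow]
    have hε := h.eps_nonneg
    gcongr
    exact (hck.pos i).le

theorem abs_slackError_le_div_ten_of_centered (hc : ∀ j < k, P.IsCentered (s j) (μ j))
    (i : Fin n) : |P.slackError s μ dsHat k i| ≤ s 0 i / 10 :=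
  (h.abs_slackError_le_of_centered hk hc i).trans (h.accumulated_error_le_div_ten hk i)

theorem le_growthFactor_mul_of_centered (hc : ∀ j ≤ k, P.IsCentered (s j) (μ j)) (i : Fin n) :
    s k i ≤ growthFactor m n * s 0 i :=
  h.centered_start.le_growthFactor_mul (hc k le_rfl) h.rank_eq (h.mu_le_mu_zero hk)
    (h.s_eq h.rank_eq hk fun j hj => (hc j hj.le).pos)
    (h.abs_slackError_le_div_ten_of_centered hk fun j hj => hc j hj.le) i

theorem primalEstimate_mul_le_of_centered (hc : ∀ j ≤ k, P.IsCentered (s j) (μ j)) (i : Fin n) :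
    P.primalEstimate (s k) (μ k) i * s 0 i ≤ growthFactor m n * μ 0 :=
  h.centered_start.primalEstimate_mul_le_growthFactor_mul (hc k le_rfl) h.rank_eq
    (h.mu_le_mu_zero hk) (h.s_eq h.rank_eq hk fun j hj => (hc j hj.le).pos)
    (h.abs_slackError_le_div_ten_of_centered hk fun j hj => hc j hj.le) i

end BeforeCentering

theorem inv_slack_le_of_centered (h : P.IsShortStepRun Λ H θ ε y s μ dsHat dy K) (hk : k < K)
    (hc : ∀ j ≤ k, P.IsCentered (s j) (μ j)) (i : Fin n) :
    (s k i)⁻¹ ≤ 2 * growthFactor m n * H ^ 2 * Λ ^ 2 := by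
  set β := growthFactor m n
  set x := P.primalEstimate (s k) (μ k) i
  have hβ : 1 ≤ β := one_le_growthFactor h.n_pos
  have hH := h.H_pos
  have hck := hc k le_rfl
  have hs := hck.pos i
  have hx : 0 < x := hck.primalEstimate_pos i
  have hxle : x ≤ β * H ^ 2 := by
    calc x ≤ x * (s 0 i * H) := le_mul_of_one_le_right hx.le (h.one_le_start_mul i)
      _ = x * s 0 i * H := by ring
      _ ≤ β * μ 0 * H :=
        mul_le_mul_of_nonneg_right (h.primalEstimate_mul_le_of_centered hk.le hc i) hH.le
      _ ≤ β * H * H := by gcongr; exact h.mu_start_le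
      _ = β * H ^ 2 := by ring
  rw [inv_le_iff_one_le_mul₀ hs]
  calc 1 = (Λ ^ 2)⁻¹ * Λ ^ 2 := (inv_mul_cancel₀ (pow_pos h.Λ_pos 2).ne').symm
    _ ≤ 2 * (x * s k i) * Λ ^ 2 := by
      gcongr
      linarith [h.guard k hk, hck.half_mu_lt i]
    _ ≤ 2 * (β * H ^ 2 * s k i) * Λ ^ 2 := by gcongr
    _ = 2 * β * H ^ 2 * Λ ^ 2 * s k i := by ring

theorem relative_error_le (h : P.IsShortStepRun Λ H θ ε y s μ dsHat dy K) (hk : k < K)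
    (hc : ∀ j ≤ k, P.IsCentered (s j) (μ j)) :
    l2norm (fun i => (s k i)⁻¹ * P.stepError (s k) (μ k) (dsHat k) i) ≤ 1 / 17 := by
  set β := growthFactor m n
  have hβ : 1 ≤ β := one_le_growthFactor h.n_pos
  have hε := h.eps_nonneg
  have hΛ := h.Λ_pos
  have hH := h.H_pos
  have hHΛ : 64 ≤ H * Λ ^ 2 := by nlinarith [h.four_le, h.le_bound, h.four_pow_le 2]
  have hslack : ∀ i, s k i ≤ 2 * β * H ^ 2 * Λ ^ 2 := fun i => by
    calc s k i ≤ β * s 0 i := h.le_growthFactor_mul_of_centered hk.le hc i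
      _ ≤ β * H := by gcongr; exact h.start_le i
      _ ≤ β * H * (H * Λ ^ 2) := le_mul_of_one_le_right (by positivity) (by linarith)
      _ ≤ 2 * (β * H * (H * Λ ^ 2)) := le_mul_of_one_le_left (by positivity) one_le_two
      _ = 2 * β * H ^ 2 * Λ ^ 2 := by ring
  refine ((h.solve k hk).l2norm_inv_mul_stepError_le (hc k le_rfl).pos hslack
    (h.inv_slack_le_of_centered hk hc) (by positivity)).trans ?_
  rw [le_div_iff₀ (by norm_num)]
  calc 2 * β * H ^ 2 * Λ ^ 2 * ε * 17 = 34 * β * (H ^ 2 * Λ ^ 2 * ε) := by ring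
    _ ≤ Λ ^ 2 * (H * Λ ^ 2) * (H ^ 2 * Λ ^ 2 * ε) :=
      mul_le_mul_of_nonneg_right (by nlinarith [h.growthFactor_le]) (by positivity)
    _ = ε * (H ^ 3 * Λ ^ 6) := by ring
    _ ≤ 1 := h.eps_mul_le

theorem isCentered (h : P.IsShortStepRun Λ H θ ε y s μ dsHat dy K) (hk : k ≤ K) :
    P.IsCentered (s k) (μ k) := by
  induction k using Nat.strong_induction_on with
  | h k ih =>
    cases k with
    | zero => exact h.centered_start
    | succ k =>
      have hc : ∀ j ≤ k, P.IsCentered (s j) (μ j) := fun j hj => ih j (by omega) (by omega)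
      rw [h.s_step_eq hk, h.mu_step k hk]
      exact (hc k le_rfl).newton_step h.rank_eq h.theta_nonneg h.theta_le h.theta_sq_mul_le
        (h.relative_error_le hk hc)

section AfterCentering

variable (h : P.IsShortStepRun Λ H θ ε y s μ dsHat dy K) (hk : k ≤ K)

include h hk

theorem le_growthFactor_mul (i : Fin n) : s k i ≤ growthFactor m n * s 0 i :=
  h.le_growthFactor_mul_of_centered hk (fun _ hj => h.isCentered (hj.trans hk)) i

theorem primalEstimate_mul_le (i : Fin n) :
    P.primalEstimate (s k) (μ k) i * s 0 i ≤ growthFactor m n * μ 0 :=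
  h.primalEstimate_mul_le_of_centered hk (fun _ hj => h.isCentered (hj.trans hk)) i

theorem abs_slackError_le (i : Fin n) : |P.slackError s μ dsHat k i| ≤ s 0 i / (H * Λ ^ 4) :=
  (h.abs_slackError_le_of_centered hk (fun _ hj => h.isCentered (hj.le.trans hk)) i).trans
    (h.accumulated_error_le hk i)

theorem mem_interiorSet : (P.primalEstimate (s k) (μ k), y k, s k) ∈
    (P.perturb (P.perturbation s dsHat dy k)).interiorSet := by
  have hc := h.isCentered hk
  exact ⟨⟨mulVec_primalEstimate h.rank_eq hc.pos hc.mu_pos.ne', h.dual_feasible h.dual_start hk,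
    fun i => (hc.primalEstimate_pos i).le, fun i => (hc.pos i).le⟩, hc.primalEstimate_pos, hc.pos⟩

theorem exists_transpose_mulVec_add_eq :
    ∃ y', P.Aᵀ *ᵥ y' + s k = P.c + P.slackError s μ dsHat k := by
  refine ⟨y 0 + ∑ j ∈ Finset.range k, P.newtonDy (s j) (μ j), ?_⟩
  have hs := h.s_eq h.rank_eq hk fun j hj => (h.isCentered (hj.le.trans hk)).pos
  rw [Matrix.mulVec_neg] at hs
  rw [Matrix.mulVec_add, ← h.dual_start]
  nth_rw 1 [hs]
  abel

end AfterCentering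

theorem l2norm_dualError_le (h : P.IsShortStepRun Λ H θ ε y s μ dsHat dy K) (hk : k < K) :
    l2norm (P.dualError (s k) (dsHat k) (dy k)) ≤ (growthFactor m n ^ 2 + 1) * (H ^ 2 * ε) := by
  set β := growthFactor m n
  have hβ : 1 ≤ β := one_le_growthFactor h.n_pos
  have hsolve := h.solve k hk
  have hc := h.isCentered hk.le
  have hH : 1 ≤ H := by linarith [h.four_le, h.le_bound]
  have hslack : l2norm (P.stepError (s k) (μ k) (dsHat k)) ≤ (β * H) ^ 2 * ε := by
    refine hsolve.l2norm_stepError_le (one_le_mul_of_one_le_of_one_le hβ hH) fun i => ?_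
    rw [abs_of_pos (hc.pos i)]
    exact (h.le_growthFactor_mul hk.le i).trans (by gcongr; exact h.start_le i)
  have hdy : l2norm (P.Aᵀ *ᵥ (dy k - P.newtonDy (s k) (μ k))) ≤ H ^ 2 * ε := by
    refine (l2norm_mulVec_le _ _).trans ?_
    rw [Finset.sum_comm]
    exact mul_le_mul h.sum_abs_le hsolve.l2norm_sub_newtonDy_le (l2norm_nonneg _) (sq_nonneg H)
  rw [dualError_eq h.rank_eq hc.pos (μ k)]
  linarith [l2norm_add_le (P.stepError (s k) (μ k) (dsHat k))
    (P.Aᵀ *ᵥ (dy k - P.newtonDy (s k) (μ k)))]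

theorem l2norm_perturbation_le (h : P.IsShortStepRun Λ H θ ε y s μ dsHat dy K) (hk : k ≤ K) :
    l2norm (P.perturbation s dsHat dy k) ≤ ε * (H ^ 3 * Λ ^ 2) := by
  have hε := h.eps_nonneg
  have hkK : (k : ℝ) ≤ K := by exact_mod_cast hk
  calc l2norm (P.perturbation s dsHat dy k)
      ≤ ∑ j ∈ Finset.range k, l2norm (P.dualError (s j) (dsHat j) (dy j)) := l2norm_sum_le _ _
    _ ≤ k * ((growthFactor m n ^ 2 + 1) * (H ^ 2 * ε)) := by
      simpa using Finset.sum_le_card_nsmul (Finset.range k) _ _ fun j hj =>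
        h.l2norm_dualError_le ((Finset.mem_range.mp hj).trans_le hk)
    _ ≤ K * ((growthFactor m n ^ 2 + 1) * (H ^ 2 * ε)) := by gcongr
    _ = K * (growthFactor m n ^ 2 + 1) * (H ^ 2 * ε) := by ring
    _ ≤ H * Λ ^ 2 * (H ^ 2 * ε) := mul_le_mul_of_nonneg_right h.passes_mul_le (by positivity)
    _ = ε * (H ^ 3 * Λ ^ 2) := by ring

theorem mul_abs_slackError_le (h : P.IsShortStepRun Λ H θ ε y s μ dsHat dy K) {a : ℝ} {i : Fin n}
    (ha : 0 ≤ a) (hai : a * s 0 i ≤ growthFactor m n * μ 0) :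
    a * |P.slackError s μ dsHat K i| ≤ μ K / 8 := by
  have hΛ := h.Λ_pos
  have hH := h.H_pos
  have hμK := h.mu_pos le_rfl
  have hμ := h.mu_start_le
  have hβ := h.growthFactor_le
  rcases K with _ | k
  · simpa [slackError] using div_nonneg hμK.le (by norm_num)
  · have hμk : 3 / 4 * (Λ ^ 2)⁻¹ ≤ μ (k + 1) := by
      rw [h.mu_step k k.lt_succ_self]
      exact mul_le_mul (by linarith [h.theta_le]) (h.guard k k.lt_succ_self).le (by positivity)
        (by linarith [h.theta_le])
    have hle : a * |P.slackError s μ dsHat (k + 1) i| ≤ 1 / 13 * (Λ ^ 2)⁻¹ := by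
      calc a * |P.slackError s μ dsHat (k + 1) i| ≤ a * (s 0 i / (H * Λ ^ 4)) := by
            gcongr
            exact h.abs_slackError_le le_rfl i
        _ = a * s 0 i * (1 / (H * Λ ^ 4)) := by ring
        _ ≤ 1 / 13 * Λ ^ 2 * H * (1 / (H * Λ ^ 4)) := by
          refine mul_le_mul_of_nonneg_right (hai.trans ?_) (by positivity)
          exact mul_le_mul (by linarith) hμ h.centered_start.mu_pos.le (by positivity)
        _ = 1 / 13 * (Λ ^ 2)⁻¹ := by field_simp
    have : 0 < (Λ ^ 2)⁻¹ := by positivity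
    linarith

theorem optimality_gap_le (h : P.IsShortStepRun Λ H θ ε y s μ dsHat dy K)
    {p : (Fin n → ℝ) × (Fin m → ℝ) × (Fin n → ℝ)} (hp : p ∈ P.optimalSet) :
    ∑ i, (P.primalEstimate (s K) (μ K) i * p.2.2 i + p.1 i * s K i) ≤ 7 / 4 * n * μ K := by
  have hc := h.isCentered le_rfl
  obtain ⟨y', hy'⟩ := h.exists_transpose_mulVec_add_eq le_rfl
  exact LO.optimality_gap_le (mulVec_primalEstimate h.rank_eq hc.pos hc.mu_pos.ne') hy'
    (fun i => (hc.primalEstimate_pos i).le) (fun i => (hc.primalEstimate_mul_lt i).le)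
    (fun i => h.mul_abs_slackError_le (hc.primalEstimate_pos i).le
      (h.primalEstimate_mul_le le_rfl i)) hp
    fun i => h.mul_abs_slackError_le (hp.1.2.2.1 i)
      (h.centered_start.optimal_mul_le_growthFactor_mul h.rank_eq h.dual_start hp i)

end IsShortStepRun

end LO

/-! ### Strict complementarity -/

section Limits

open Filter Topology

variable {α ι : Type*} {l : Filter α}

theorem tendsto_mul_div_of_mul_eq {x s q μ : α → ℝ} {a b : ℝ} (hμ : ∀ k, μ k ≠ 0)
    (hxs : ∀ k, x k * s k = μ k * q k) (hx : Tendsto x l (𝓝 a)) (ha : a ≠ 0)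
    (hq : Tendsto q l (𝓝 b)) : Tendsto (fun k => a * s k / μ k) l (𝓝 b) := by
  have hlim := (hq.const_mul a).div hx ha
  rw [mul_div_cancel_left₀ _ ha] at hlim
  refine hlim.congr' ?_
  filter_upwards [hx.eventually_ne ha] with k hk
  rw [Pi.div_apply, div_eq_div_iff hk (hμ k)]
  linear_combination -a * hxs k

/-- Orthogonality says `∑ (x' s + x s') / μ = ∑ x s / μ`. An index with `x' = s' = 0` contributes
nothing on the left but a positive amount in the limit on the right, while at every other index the
two sides have the same limit. -/
theorem ne_zero_or_ne_zero_of_tendsto [Fintype ι] [l.NeBot] {x s q : α → ι → ℝ} {μ : α → ℝ}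
    {x' s' q' : ι → ℝ} (hμ : ∀ k, μ k ≠ 0) (hxs : ∀ k i, x k i * s k i = μ k * q k i)
    (hx : Tendsto x l (𝓝 x')) (hs : Tendsto s l (𝓝 s')) (hq : Tendsto q l (𝓝 q'))
    (hq' : ∀ i, 0 < q' i) (hcomp : ∀ i, x' i * s' i = 0)
    (horth : ∀ k, (x k - x') ⬝ᵥ (s k - s') = 0) (i : ι) : x' i ≠ 0 ∨ s' i ≠ 0 := by
  classical
  rw [tendsto_pi_nhds] at hx hs hq
  have hlim : ∀ i, Tendsto (fun k => (x' i * s k i + s' i * x k i) / μ k) l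
      (𝓝 (if x' i = 0 ∧ s' i = 0 then 0 else q' i)) := fun i => by
    by_cases hx' : x' i = 0
    · by_cases hs' : s' i = 0
      · simp [hx', hs']
      · simpa [hx', hs'] using tendsto_mul_div_of_mul_eq hμ
          (fun k => (mul_comm _ _).trans (hxs k i)) (hs i) hs' (hq i)
    · have hs' : s' i = 0 := (mul_eq_zero.mp (hcomp i)).resolve_left hx'
      simpa [hx', hs'] using tendsto_mul_div_of_mul_eq hμ (fun k => hxs k i) (hx i) hx' (hq i)
  have hsum : ∀ k, ∑ i, (x' i * s k i + s' i * x k i) / μ k = ∑ i, q k i := fun k => by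
    rw [← sub_eq_zero, ← Finset.sum_sub_distrib, ← zero_div (-μ k), ← horth k, dotProduct,
      Finset.sum_div]
    refine Finset.sum_congr rfl fun i _ => ?_
    rw [Pi.sub_apply, Pi.sub_apply, eq_div_iff (neg_ne_zero.mpr (hμ k)), sub_mul, mul_neg,
      div_mul_cancel₀ _ (hμ k)]
    linear_combination -hcomp i - hxs k i
  have heq : ∑ i, (if x' i = 0 ∧ s' i = 0 then 0 else q' i) = ∑ i, q' i :=
    tendsto_nhds_unique (tendsto_finsetSum _ fun i _ => hlim i)
      (by simpa only [hsum] using tendsto_finsetSum Finset.univ fun i _ => hq i)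
  rw [Finset.sum_eq_sum_iff_of_le fun i _ => by split_ifs; exacts [(hq' i).le, le_rfl]] at heq
  by_contra! hi
  have := heq i (Finset.mem_univ i)
  rw [if_pos hi] at this
  exact (hq' i).ne this

end Limits

namespace LO

open Filter Topology

variable {m n : ℕ} {P : LO m n} {s₀ : Fin n → ℝ} {y₀ : Fin m → ℝ} {μ₀ : ℝ}

theorem IsCentered.exists_isCentered_pow_mul (h₀ : P.IsCentered s₀ μ₀) (hA : P.A.rank = m)
    (hdual : P.Aᵀ *ᵥ y₀ + s₀ = P.c) {θ : ℝ} (hθ : 0 ≤ θ) (hθ4 : θ ≤ 1 / 4)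
    (hθn : θ ^ 2 * n ≤ 1 / 16) (k : ℕ) :
    ∃ y s, P.Aᵀ *ᵥ y + s = P.c ∧ P.IsCentered s ((1 - θ) ^ k * μ₀) := by
  induction k with
  | zero => exact ⟨y₀, s₀, hdual, by simpa using h₀⟩
  | succ k ih =>
    obtain ⟨y, s, hys, hs⟩ := ih
    set μ := (1 - θ) ^ k * μ₀
    have hzero : l2norm (fun i => (s i)⁻¹ * (0 : Fin n → ℝ) i) ≤ 1 / 17 := by
      simp only [Pi.zero_apply, mul_zero]
      exact l2norm_zero.le.trans (by norm_num)
    refine ⟨y + P.newtonDy s μ, s + P.newtonDs s μ, ?_, ?_⟩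
    · rw [newtonDs_eq_transpose_mulVec hA hs.pos, Matrix.mulVec_add, Matrix.mulVec_neg, ← hys]
      abel
    · rw [pow_succ', mul_assoc]
      simpa only [add_zero] using hs.newton_step hA hθ hθ4 hθn hzero

theorem IsCentered.exists_tendsto_zero (h₀ : P.IsCentered s₀ μ₀) (hA : P.A.rank = m) (hn : 0 < n)
    (hdual : P.Aᵀ *ᵥ y₀ + s₀ = P.c) :
    ∃ (y : ℕ → Fin m → ℝ) (s : ℕ → Fin n → ℝ) (μ : ℕ → ℝ), Tendsto μ atTop (𝓝 0) ∧
      ∀ k, P.Aᵀ *ᵥ y k + s k = P.c ∧ P.IsCentered (s k) (μ k) ∧ μ k ≤ μ₀ := by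
  have hn1 : (1 : ℝ) ≤ n := by exact_mod_cast hn
  have hθ : (0 : ℝ) < 1 / (4 * n) := by positivity
  have hθ4 : (1 : ℝ) / (4 * n) ≤ 1 / 4 := by
    rw [div_le_div_iff₀ (by positivity) (by norm_num)]
    linarith
  have hθn : (1 / (4 * n) : ℝ) ^ 2 * n ≤ 1 / 16 := by
    field_simp
    linarith
  choose y s hys hs using h₀.exists_isCentered_pow_mul hA hdual hθ.le hθ4 hθn
  refine ⟨y, s, fun k => (1 - 1 / (4 * n)) ^ k * μ₀, ?_, fun k => ⟨hys k, hs k, ?_⟩⟩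
  · simpa using (tendsto_pow_atTop_nhds_zero_of_lt_one (r := 1 - 1 / (4 * (n : ℝ))) (by linarith)
      (by linarith)).mul_const μ₀
  · exact mul_le_of_le_one_left h₀.mu_pos.le (pow_le_one₀ (by linarith) (by linarith))

/-- Near-central points with `μ ≤ μ₀` stay in a box: their slacks and primal entries by the growth
bounds, and the ratios `xᵢ sᵢ / μ` by centrality. -/
theorem IsCentered.exists_tendsto_subseq (h₀ : P.IsCentered s₀ μ₀) (hA : P.A.rank = m)
    (hdual : P.Aᵀ *ᵥ y₀ + s₀ = P.c) {y : ℕ → Fin m → ℝ} {s : ℕ → Fin n → ℝ} {μ : ℕ → ℝ}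
    (hys : ∀ k, P.Aᵀ *ᵥ y k + s k = P.c) (hc : ∀ k, P.IsCentered (s k) (μ k))
    (hμ : ∀ k, μ k ≤ μ₀) :
    ∃ (x' s' q' : Fin n → ℝ) (φ : ℕ → ℕ), StrictMono φ ∧ 0 ≤ x' ∧ 0 ≤ s' ∧ (∀ i, 0 < q' i) ∧
      Tendsto (fun k => P.primalEstimate (s (φ k)) (μ (φ k))) atTop (𝓝 x') ∧
      Tendsto (s ∘ φ) atTop (𝓝 s') ∧
      Tendsto (fun k i => P.primalEstimate (s (φ k)) (μ (φ k)) i * s (φ k) i / μ (φ k)) atTop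
        (𝓝 q') := by
  set β := growthFactor m n
  have hdual' : ∀ k, s k = s₀ + 0 + P.Aᵀ *ᵥ (y₀ - y k) := fun k => by
    rw [Matrix.mulVec_sub, eq_sub_of_add_eq' (hys k), ← hdual]
    abel
  have hzero : ∀ i, |(0 : Fin n → ℝ) i| ≤ s₀ i / 10 := fun i => by
    simpa using div_nonneg (h₀.pos i).le (by norm_num)
  have hmem : ∀ k, (P.primalEstimate (s k) (μ k), s k,
      fun i => P.primalEstimate (s k) (μ k) i * s k i / μ k) ∈
      Set.Icc ((0, 0, fun _ => 1 / 2) : (Fin n → ℝ) × (Fin n → ℝ) × (Fin n → ℝ))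
        (fun i => β * μ₀ / s₀ i, fun i => β * s₀ i, fun _ => 3 / 2) := fun k =>
    ⟨⟨fun i => ((hc k).primalEstimate_pos i).le, fun i => ((hc k).pos i).le, fun i =>
        (le_div_iff₀ (hc k).mu_pos).mpr (by linarith [(hc k).half_mu_lt i])⟩,
      ⟨fun i => (le_div_iff₀ (h₀.pos i)).mpr
          (h₀.primalEstimate_mul_le_growthFactor_mul (hc k) hA (hμ k) (hdual' k) hzero i),
        h₀.le_growthFactor_mul (hc k) hA (hμ k) (hdual' k) hzero, fun i =>
        (div_le_iff₀ (hc k).mu_pos).mpr ((hc k).primalEstimate_mul_lt i).le⟩⟩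
  obtain ⟨⟨x', s', q'⟩, hlimmem, φ, hφ, hlim⟩ := isCompact_Icc.tendsto_subseq hmem
  exact ⟨x', s', q', φ, hφ, hlimmem.1.1, hlimmem.1.2.1,
    fun i => one_half_pos.trans_le (hlimmem.1.2.2 i), (continuous_fst.tendsto _).comp hlim,
    (continuous_snd.fst.tendsto _).comp hlim, (continuous_snd.snd.tendsto _).comp hlim⟩

theorem exists_transpose_mulVec_add_eq_of_tendsto {α : Type*} {l : Filter α} [l.NeBot]
    {y : α → Fin m → ℝ} {s : α → Fin n → ℝ} {s' : Fin n → ℝ}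
    (hys : ∀ k, P.Aᵀ *ᵥ y k + s k = P.c) (hs : Tendsto s l (𝓝 s')) :
    ∃ y', P.Aᵀ *ᵥ y' + s' = P.c := by
  have hmem : P.c - s' ∈ (LinearMap.range (Matrix.mulVecLin P.Aᵀ) : Set (Fin n → ℝ)) :=
    (Submodule.closed_of_finiteDimensional _).mem_of_tendsto (hs.const_sub P.c)
      (Eventually.of_forall fun k => ⟨y k, by rw [Matrix.mulVecLin_apply, ← hys k]; abel⟩)
  obtain ⟨y', hy'⟩ := hmem
  exact ⟨y', by rw [← Matrix.mulVecLin_apply, hy', sub_add_cancel]⟩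

theorem mulVec_eq_of_tendsto {α : Type*} {l : Filter α} [l.NeBot] {x : α → Fin n → ℝ}
    {x' : Fin n → ℝ} (hAx : ∀ k, P.A *ᵥ x k = P.b) (hx : Tendsto x l (𝓝 x')) :
    P.A *ᵥ x' = P.b := by
  have hcont : Continuous fun v : Fin n → ℝ => P.A *ᵥ v := by fun_prop
  refine tendsto_nhds_unique ((hcont.tendsto x').comp hx) ?_
  simp [Function.comp_def, hAx]

theorem IsCentered.exists_strictly_complementary (h₀ : P.IsCentered s₀ μ₀) (hA : P.A.rank = m)
    (hn : 0 < n) (hdual : P.Aᵀ *ᵥ y₀ + s₀ = P.c) :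
    ∃ p ∈ P.optimalSet, ∀ i, 0 < p.1 i ∨ 0 < p.2.2 i := by
  obtain ⟨y, s, μ, hμlim, hseq⟩ := h₀.exists_tendsto_zero hA hn hdual
  have hc : ∀ k, P.IsCentered (s k) (μ k) := fun k => (hseq k).2.1
  obtain ⟨x', s', q', φ, hφ, hx', hs', hq', hxlim, hslim, hqlim⟩ :=
    h₀.exists_tendsto_subseq hA hdual (fun k => (hseq k).1) hc fun k => (hseq k).2.2
  have hAx : ∀ k, P.A *ᵥ P.primalEstimate (s (φ k)) (μ (φ k)) = P.b := fun k =>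
    mulVec_primalEstimate hA (hc _).pos (hc _).mu_pos.ne'
  have hAx' : P.A *ᵥ x' = P.b := mulVec_eq_of_tendsto hAx hxlim
  obtain ⟨y', hy'⟩ := exists_transpose_mulVec_add_eq_of_tendsto (fun k => (hseq (φ k)).1) hslim
  have hprod : ∀ k i, P.primalEstimate (s (φ k)) (μ (φ k)) i * s (φ k) i
      = μ (φ k) * (P.primalEstimate (s (φ k)) (μ (φ k)) i * s (φ k) i / μ (φ k)) := fun k i =>
    (mul_div_cancel₀ _ (hc _).mu_pos.ne').symm
  have hcomp : ∀ i, x' i * s' i = 0 := fun i => by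
    refine tendsto_nhds_unique ((tendsto_pi_nhds.mp hxlim i).mul (tendsto_pi_nhds.mp hslim i)) ?_
    have := (hμlim.comp hφ.tendsto_atTop).mul (tendsto_pi_nhds.mp hqlim i)
    rw [zero_mul] at this
    exact this.congr fun k => (hprod k i).symm
  refine ⟨(x', y', s'), ⟨⟨hAx', hy', hx', hs'⟩, Finset.sum_eq_zero fun i _ => hcomp i⟩, fun i => ?_⟩
  exact (ne_zero_or_ne_zero_of_tendsto (fun k => (hc (φ k)).mu_pos.ne') hprod hxlim hslim hqlim hq'
    hcomp (fun k => dotProduct_sub_eq_zero (hAx k) hAx' (hseq (φ k)).1 hy') i).imp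
    (fun h => (hx' i).lt_of_ne' h) fun h => (hs' i).lt_of_ne' h

end LO

/-! ### Vertices and Cramer's rule -/

section MinimalSupport

variable {𝕜 ι : Type*} [Field 𝕜] [LinearOrder 𝕜] [IsStrictOrderedRing 𝕜] [Finite ι]

theorem exists_nonneg_add_smul_apply_eq_zero {v w : ι → 𝕜} (hv : 0 ≤ v) (hw : ∃ j, w j < 0) :
    ∃ t : 𝕜, 0 ≤ t ∧ 0 ≤ v + t • w ∧ ∃ j, w j < 0 ∧ (v + t • w) j = 0 := by
  classical
  cases nonempty_fintype ι
  have hne : (Finset.univ.filter fun j => w j < 0).Nonempty := by simpa [Finset.Nonempty] using hw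
  obtain ⟨j, hj, hmin⟩ := Finset.exists_min_image _ (fun j => v j / -w j) hne
  have hwj : 0 < -w j := neg_pos.mpr (Finset.mem_filter.mp hj).2
  have ht : 0 ≤ v j / -w j := div_nonneg (hv j) hwj.le
  refine ⟨v j / -w j, ht, fun l => ?_, j, neg_pos.mp hwj, ?_⟩
  · rw [Pi.zero_apply, Pi.add_apply, Pi.smul_apply, smul_eq_mul]
    rcases le_or_gt 0 (w l) with hl | hl
    · exact add_nonneg (hv l) (mul_nonneg ht hl)
    · have hle := hmin l (Finset.mem_filter.mpr ⟨Finset.mem_univ l, hl⟩)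
      rw [le_div_iff₀ (neg_pos.mpr hl)] at hle
      linarith
  · rw [Pi.add_apply, Pi.smul_apply, smul_eq_mul, ← neg_neg (w j), mul_neg, neg_neg,
      div_mul_cancel₀ _ hwj.ne', add_neg_cancel]

/-- Moving along a nonzero `w ∈ W` supported on the support of `v` until a coordinate vanishes
shrinks the support; the sign of `w` is chosen such that coordinate `i` does not decrease. -/
theorem exists_minimal_support (W : Submodule 𝕜 (ι → 𝕜)) (i : ι) (v : ι → 𝕜) (hv : 0 ≤ v)
    (hrec : ∀ w ∈ W, 0 ≤ w → (∀ j, v j = 0 → w j = 0) → w = 0) :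
    ∃ v', v' - v ∈ W ∧ 0 ≤ v' ∧ (∀ j, v j = 0 → v' j = 0) ∧ v i ≤ v' i ∧
      ∀ w ∈ W, (∀ j, v' j = 0 → w j = 0) → w = 0 := by
  classical
  cases nonempty_fintype ι
  induction hc : (Finset.univ.filter fun j => v j ≠ 0).card using Nat.strong_induction_on
    generalizing v with
  | _ c ih =>
  by_cases hmin : ∀ w ∈ W, (∀ j, v j = 0 → w j = 0) → w = 0
  · exact ⟨v, by simp, hv, fun _ h => h, le_rfl, hmin⟩
  obtain ⟨w, hwW, hwv, hw0, hwi⟩ : ∃ w ∈ W, (∀ j, v j = 0 → w j = 0) ∧ w ≠ 0 ∧ 0 ≤ w i := by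
    push Not at hmin
    obtain ⟨w, hwW, hwv, hw0⟩ := hmin
    rcases le_total 0 (w i) with h | h
    · exact ⟨w, hwW, hwv, hw0, h⟩
    · exact ⟨-w, W.neg_mem hwW, fun j hj => by simp [hwv j hj], neg_ne_zero.mpr hw0,
        by simpa using h⟩
  have hneg : ∃ j, w j < 0 := by
    by_contra! hnonneg
    exact hw0 (hrec w hwW hnonneg hwv)
  obtain ⟨t, ht, hu, j, hwj, huj⟩ := exists_nonneg_add_smul_apply_eq_zero hv hneg
  have huv : ∀ l, v l = 0 → (v + t • w) l = 0 := fun l hl => by simp [hl, hwv l hl]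
  have hlt : (Finset.univ.filter fun l => (v + t • w) l ≠ 0).card < c := by
    rw [← hc]
    refine Finset.card_lt_card ((Finset.ssubset_iff_of_subset fun l hl => ?_).mpr ⟨j, ?_, ?_⟩)
    · exact Finset.mem_filter.mpr ⟨Finset.mem_univ l, mt (huv l) (Finset.mem_filter.mp hl).2⟩
    · exact Finset.mem_filter.mpr ⟨Finset.mem_univ j, mt (hwv j) hwj.ne⟩
    · simp only [Finset.mem_filter, huj, ne_eq, not_true_eq_false, and_false, not_false_eq_true]
  obtain ⟨v', hsub, hv', hsupp, hvi, hmin'⟩ := ih _ hlt (v + t • w) hu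
    (fun w' hw' hw'0 hs => hrec w' hw' hw'0 fun l hl => hs l (huv l hl)) rfl
  refine ⟨v', ?_, hv', fun l hl => hsupp l (huv l hl), ?_, hmin'⟩
  · have hadd : v' - v = v' - (v + t • w) + t • w := by abel
    exact hadd ▸ W.add_mem hsub (W.smul_mem t hwW)
  · exact (le_add_of_nonneg_right (mul_nonneg ht hwi)).trans hvi

end MinimalSupport

section Columns

variable {ι κ 𝕜 : Type*} [Field 𝕜] [Fintype κ] {A : Matrix ι κ 𝕜} {S : Set κ}

theorem linearCombination_col (A : Matrix ι κ 𝕜) (l : κ →₀ 𝕜) :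
    Finsupp.linearCombination 𝕜 A.col l = A *ᵥ l := by
  rw [Finsupp.linearCombination_apply, Finsupp.sum_fintype _ _ (by simp)]
  funext i
  simp [Matrix.mulVec, dotProduct, Matrix.col, mul_comm]

theorem mem_span_col_image {f : ι → 𝕜} : f ∈ Submodule.span 𝕜 (A.col '' S) ↔
    ∃ u : κ → 𝕜, (∀ j ∉ S, u j = 0) ∧ A *ᵥ u = f := by
  rw [Finsupp.mem_span_image_iff_linearCombination]
  simp only [Finsupp.mem_supported', linearCombination_col]
  exact (Finsupp.equivFunOnFinite (α := κ) (M := 𝕜)).exists_congr fun l => Iff.rfl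

theorem linearIndepOn_col_iff : LinearIndepOn 𝕜 A.col S ↔
    ∀ u : κ → 𝕜, (∀ j ∉ S, u j = 0) → A *ᵥ u = 0 → u = 0 := by
  simp only [linearIndepOn_iff, Finsupp.mem_supported', linearCombination_col]
  refine (Finsupp.equivFunOnFinite (α := κ) (M := 𝕜)).forall_congr fun l => ?_
  rw [← DFunLike.coe_fn_eq (f := l)]
  rfl

theorem eq_zero_of_transpose_mulVec_eq_zero [Fintype ι] (hA : A.rank = Fintype.card ι) {v : ι → 𝕜}
    (hv : Aᵀ *ᵥ v = 0) : v = 0 := by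
  have hli : LinearIndependent 𝕜 A.row := by
    rw [linearIndependent_iff_card_eq_finrank_span, Set.finrank, ← Matrix.rank_eq_finrank_span_row,
      hA]
  rw [Matrix.mulVec_transpose] at hv
  exact Matrix.vecMul_injective_iff.mpr hli (hv.trans (Matrix.zero_vecMul _).symm)

omit [Fintype κ] in
theorem span_col_image_eq_top [Fintype ι]
    (h : ∀ v : ι → 𝕜, (∀ j ∈ S, (Aᵀ *ᵥ v) j = 0) → v = 0) :
    Submodule.span 𝕜 (A.col '' S) = ⊤ := by
  classical
  by_contra hne
  obtain ⟨f, hf₀, hf⟩ := Submodule.exists_le_ker_of_lt_top _ (lt_top_iff_ne_top.mpr hne)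
  obtain ⟨v, rfl⟩ := (dotProductEquiv 𝕜 ι).surjective f
  have hv : v = 0 := h v fun j hj => by
    have hcol : v ⬝ᵥ A.col j = 0 := hf (Submodule.subset_span ⟨j, hj, rfl⟩)
    exact (dotProduct_comm (A.col j) v).trans hcol
  exact hf₀ (by rw [hv, map_zero])

variable [Fintype ι] [DecidableEq ι]

/-- The columns `g k` of `A` form a basis of the column space (a nonsingular square submatrix), and
those of them that lie in `T` already span all the columns in `T`. -/
structure SelectsBasis (A : Matrix ι κ 𝕜) (T : Set κ) (g : ι → κ) : Prop where
  det_ne_zero : (A.submatrix id g).det ≠ 0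
  col_mem_span : ∀ j ∈ T, A.col j ∈ Submodule.span 𝕜 (A.col '' (T ∩ Set.range g))

omit [Fintype κ] in
theorem exists_selectsBasis {J₀ T Z : Set κ} (hJ₀ : LinearIndepOn 𝕜 A.col J₀) (hJT : J₀ ⊆ T)
    (hTZ : T ⊆ Z) (hZ : Submodule.span 𝕜 (A.col '' Z) = ⊤) :
    ∃ g, SelectsBasis A T g ∧ J₀ ⊆ Set.range g ∧ ∀ k, g k ∈ Z := by
  obtain ⟨J, hJT', hJ₀J, hTspan, hJ⟩ := exists_linearIndepOn_extension hJ₀ hJT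
  obtain ⟨M, hMZ, hJM, hZspan, hM⟩ := exists_linearIndepOn_extension hJ (hJT'.trans hTZ)
  have hMtop : Submodule.span 𝕜 (A.col '' M) = ⊤ :=
    eq_top_iff.mpr (hZ ▸ Submodule.span_le.mpr hZspan)
  let b := Module.Basis.mk hM (by rw [← hMtop, Set.image_eq_range])
  have : Finite M := Module.Finite.finite_basis b
  have hcard : Nat.card ι = Nat.card M := by
    rw [← Module.finrank_eq_nat_card_basis b, Module.finrank_fintype_fun_eq_card,
      Nat.card_eq_fintype_card]
  obtain ⟨e⟩ : Nonempty (ι ≃ M) := Finite.card_eq.mp hcard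
  have hJrange : J ⊆ Set.range fun k => (e k : κ) := fun j hj => ⟨e.symm ⟨j, hJM hj⟩, by simp⟩
  refine ⟨fun k => e k, ⟨?_, fun j hj => ?_⟩, hJ₀J.trans hJrange, fun k => hMZ (e k).2⟩
  · have hli : LinearIndependent 𝕜 (A.submatrix id fun k => (e k : κ)).col :=
      hM.comp e e.injective
    rw [Matrix.linearIndependent_cols_iff_isUnit, Matrix.isUnit_iff_isUnit_det] at hli
    exact hli.ne_zero
  · exact Submodule.span_mono (Set.image_mono (Set.subset_inter hJT' hJrange))
      (hTspan ⟨j, hj, rfl⟩)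

end Columns

section Cramer

variable {ι κ R : Type*} [Fintype ι] [DecidableEq ι] [CommRing R]

theorem injective_of_det_submatrix_ne_zero {A : Matrix ι κ R} {g : ι → κ}
    (hg : (A.submatrix id g).det ≠ 0) : Function.Injective g := fun k l hkl => by
  by_contra hne
  exact hg (Matrix.det_zero_of_column_eq hne fun i => by simp [hkl])

theorem cramer_submatrix_col (A : Matrix ι κ R) (g : ι → κ) (j : κ) (k : ι) :
    (A.submatrix id g).cramer (A.col j) k = (A.submatrix id (Function.update g k j)).det := by
  rw [Matrix.cramer_apply]
  congr 1
  ext a b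
  rcases eq_or_ne b k with rfl | hb
  · simp [Matrix.col]
  · simp [hb]

theorem det_submatrix_mul_transpose_mulVec (A : Matrix ι κ R) (g : ι → κ) (y : ι → R) (j : κ) :
    (A.submatrix id g).det * (Aᵀ *ᵥ y) j =
      ∑ k, (Aᵀ *ᵥ y) (g k) * (A.submatrix id (Function.update g k j)).det := by
  have hcol : (Aᵀ *ᵥ y) j = y ⬝ᵥ A.col j := dotProduct_comm _ _
  rw [hcol, ← smul_eq_mul, ← dotProduct_smul, ← Matrix.mulVec_cramer (A.submatrix id g),
    Matrix.dotProduct_mulVec, dotProduct]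
  refine Finset.sum_congr rfl fun k _ => ?_
  rw [cramer_submatrix_col]
  exact congrArg (· * _) (dotProduct_comm _ _)

variable [Fintype κ]

theorem det_submatrix_mul_apply (A : Matrix ι κ R) {g : ι → κ} (hg : Function.Injective g)
    {u : κ → R} (hu : ∀ j, j ∉ Set.range g → u j = 0) (k : ι) :
    (A.submatrix id g).det * u (g k) = (A.submatrix id g).cramer (A *ᵥ u) k := by
  have hAu : A *ᵥ u = A.submatrix id g *ᵥ (u ∘ g) := by
    funext i
    exact (Fintype.sum_of_injective g hg _ _ (fun j hj => by simp [hu j hj]) fun _ => rfl).symm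
  rw [hAu, Matrix.cramer_eq_adjugate_mulVec, Matrix.mulVec_mulVec, Matrix.adjugate_mul,
    Matrix.smul_mulVec, Matrix.one_mulVec]
  rfl

theorem cramer_mulVec (A : Matrix ι κ R) (g : ι → κ) (u : κ → R) (k : ι) :
    (A.submatrix id g).cramer (A *ᵥ u) k =
      ∑ j, u j * (A.submatrix id (Function.update g k j)).det := by
  have hAu : A *ᵥ u = ∑ j, u j • A.col j := by
    funext i
    simp [Matrix.mulVec, dotProduct, Matrix.col, mul_comm]
  rw [hAu, map_sum, Finset.sum_apply]
  refine Finset.sum_congr rfl fun j _ => ?_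
  rw [map_smul, Pi.smul_apply, cramer_submatrix_col, smul_eq_mul]

end Cramer

section DetBounds

variable {ι κ R : Type*} [Fintype ι] [DecidableEq ι] [CommRing R] [LinearOrder R]
  [IsStrictOrderedRing R]

theorem abs_det_submatrix_mul_transpose_mulVec_le {A : Matrix ι κ R} {D a : R}
    (hD : ∀ g : ι → κ, |(A.submatrix id g).det| ≤ D) {g : ι → κ} {y : ι → R}
    (hy : ∀ k, |(Aᵀ *ᵥ y) (g k)| ≤ a) (j : κ) :
    |(A.submatrix id g).det| * |(Aᵀ *ᵥ y) j| ≤ Fintype.card ι * (a * D) := by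
  rw [← abs_mul, det_submatrix_mul_transpose_mulVec, ← nsmul_eq_mul]
  refine (Finset.abs_sum_le_sum_abs _ _).trans (Finset.sum_le_card_nsmul _ _ _ fun k _ => ?_)
  rw [abs_mul]
  exact mul_le_mul (hy k) (hD _) (abs_nonneg _) ((abs_nonneg _).trans (hy k))

theorem abs_det_submatrix_mul_le [Fintype κ] {A : Matrix ι κ R} {D a : R}
    (hD : ∀ g : ι → κ, |(A.submatrix id g).det| ≤ D) {g : ι → κ} (hg : Function.Injective g)
    {u w : κ → R} (hu : ∀ j, |u j| ≤ a) (hw : ∀ j, j ∉ Set.range g → w j = 0)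
    (huw : A *ᵥ w = A *ᵥ u) (k : ι) :
    |(A.submatrix id g).det| * |w (g k)| ≤ Fintype.card κ * (a * D) := by
  rw [← abs_mul, det_submatrix_mul_apply A hg hw, huw, cramer_mulVec, ← nsmul_eq_mul]
  refine (Finset.abs_sum_le_sum_abs _ _).trans (Finset.sum_le_card_nsmul _ _ _ fun j _ => ?_)
  rw [abs_mul]
  exact mul_le_mul (hu j) (hD _) (abs_nonneg _) ((abs_nonneg _).trans (hu j))

theorem abs_det_le_prod_sum (M : Matrix ι ι R) : |M.det| ≤ ∏ k, ∑ i, |M i k| := by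
  calc |M.det| ≤ ∑ σ : Equiv.Perm ι, ∏ k, |M (σ k) k| := by
        rw [Matrix.det_apply]
        refine (Finset.abs_sum_le_sum_abs _ _).trans_eq (Finset.sum_congr rfl fun σ _ => ?_)
        rw [← Finset.abs_prod]
        rcases Int.units_eq_one_or (Equiv.Perm.sign σ) with h | h <;> simp [h]
    _ = ∑ p ∈ Finset.univ.image fun σ : Equiv.Perm ι => (σ : ι → ι), ∏ k, |M (p k) k| := by
        rw [Finset.sum_image fun σ _ τ _ h => DFunLike.coe_injective h]
    _ ≤ ∑ p : ι → ι, ∏ k, |M (p k) k| :=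
        Finset.sum_le_sum_of_subset_of_nonneg (Finset.subset_univ _)
          fun p _ _ => Finset.prod_nonneg fun k _ => abs_nonneg _
    _ = ∏ k, ∑ i, |M i k| := by
        rw [Finset.prod_univ_sum, Fintype.piFinset_univ]

omit [DecidableEq ι] in
theorem sum_le_prod_add_one {f : ι → R} (hf : ∀ i, 0 ≤ f i) : ∑ i, f i ≤ ∏ i, (f i + 1) := by
  classical
  suffices ∀ s : Finset ι, ∑ i ∈ s, f i + 1 ≤ ∏ i ∈ s, (f i + 1) by linarith [this Finset.univ]
  intro s
  induction s using Finset.induction_on with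
  | empty => simp
  | insert a s ha ih =>
    rw [Finset.sum_insert ha, Finset.prod_insert ha]
    nlinarith [hf a, Finset.sum_nonneg fun i (_ : i ∈ s) => hf i]

theorem abs_det_submatrix_le_prod_prod [Fintype κ] (A : Matrix ι κ R) (g : ι → κ) :
    |(A.submatrix id g).det| ≤ ∏ i, ∏ j, (|A i j| + 1) := by
  classical
  by_cases hdet : (A.submatrix id g).det = 0
  · rw [hdet, abs_zero]
    exact Finset.prod_nonneg fun i _ => Finset.prod_nonneg fun j _ => by positivity
  have hg := injective_of_det_submatrix_ne_zero hdet
  calc |(A.submatrix id g).det| ≤ ∏ k, ∑ i, |A i (g k)| := abs_det_le_prod_sum _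
    _ ≤ ∏ k, ∏ i, (|A i (g k)| + 1) :=
        Finset.prod_le_prod (fun k _ => Finset.sum_nonneg fun i _ => abs_nonneg _)
          fun k _ => sum_le_prod_add_one fun i => abs_nonneg _
    _ = ∏ j ∈ Finset.univ.image g, ∏ i, (|A i j| + 1) := by
        rw [Finset.prod_image fun a _ b _ h => hg h]
    _ ≤ ∏ j, ∏ i, (|A i j| + 1) :=
        Finset.prod_le_prod_of_subset_of_one_le (Finset.subset_univ _)
          (fun j _ => Finset.prod_nonneg fun i _ => by positivity)
          fun j _ _ => Finset.one_le_prod fun i _ => by simp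
    _ = ∏ i, ∏ j, (|A i j| + 1) := Finset.prod_comm

end DetBounds

/-! ### The optimal partition -/

section Repair

variable {ι κ 𝕜 : Type*} [Fintype ι] [DecidableEq ι] [Field 𝕜] [LinearOrder 𝕜]
  [IsStrictOrderedRing 𝕜] {A : Matrix ι κ 𝕜} {T : Set κ} {g : ι → κ} {D a : 𝕜}

theorem SelectsBasis.exists_mulVec_eq [Fintype κ] (hg : SelectsBasis A T g)
    (hD : ∀ g : ι → κ, |(A.submatrix id g).det| ≤ D) {u : κ → 𝕜}
    (hu : A *ᵥ u ∈ Submodule.span 𝕜 (A.col '' T)) (ha : ∀ j, |u j| ≤ a) (ha₀ : 0 ≤ a) :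
    ∃ v, A *ᵥ v = A *ᵥ u ∧ (∀ j ∉ T, v j = 0) ∧
      ∀ j, |(A.submatrix id g).det| * |v j| ≤ Fintype.card κ * (a * D) := by
  have hspan : A *ᵥ u ∈ Submodule.span 𝕜 (A.col '' (T ∩ Set.range g)) := by
    refine Submodule.span_le.mpr ?_ hu
    rintro _ ⟨j, hj, rfl⟩
    exact hg.col_mem_span j hj
  obtain ⟨v, hv, hAv⟩ := mem_span_col_image.mp hspan
  have hvg : ∀ j, j ∉ Set.range g → v j = 0 := fun j hj => hv j fun h => hj h.2
  refine ⟨v, hAv, fun j hj => hv j fun h => hj h.1, fun j => ?_⟩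
  by_cases hj : j ∈ Set.range g
  · obtain ⟨k, rfl⟩ := hj
    exact abs_det_submatrix_mul_le hD (injective_of_det_submatrix_ne_zero hg.det_ne_zero) ha hvg
      hAv k
  · have hD₀ : 0 ≤ D := (abs_nonneg _).trans (hD g)
    rw [hvg j hj, abs_zero, mul_zero]
    positivity

theorem SelectsBasis.exists_transpose_mulVec_eq (hg : SelectsBasis A T g)
    (hD : ∀ g : ι → κ, |(A.submatrix id g).det| ≤ D) {y : ι → 𝕜}
    (ha : ∀ j ∈ T, |(Aᵀ *ᵥ y) j| ≤ a) (ha₀ : 0 ≤ a) :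
    ∃ z, (∀ j ∈ T, (Aᵀ *ᵥ z) j = (Aᵀ *ᵥ y) j) ∧
      ∀ j, |(A.submatrix id g).det| * |(Aᵀ *ᵥ z) j| ≤ Fintype.card ι * (a * D) := by
  classical
  have hunit : IsUnit ((A.submatrix id g)ᵀ).det := by
    rw [Matrix.det_transpose]
    exact hg.det_ne_zero.isUnit
  let v : ι → 𝕜 := fun k => if g k ∈ T then (Aᵀ *ᵥ y) (g k) else 0
  let z : ι → 𝕜 := ((A.submatrix id g)ᵀ)⁻¹ *ᵥ v
  have hz : ∀ k, (Aᵀ *ᵥ z) (g k) = v k := congrFun (by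
    change (A.submatrix id g)ᵀ *ᵥ z = v
    rw [Matrix.mulVec_mulVec, Matrix.mul_nonsing_inv _ hunit, Matrix.one_mulVec])
  have hva : ∀ k, |(Aᵀ *ᵥ z) (g k)| ≤ a := fun k => by
    rw [hz]
    by_cases hk : g k ∈ T
    · simpa only [v, hk, if_true] using ha _ hk
    · simpa only [v, hk, if_false, abs_zero] using ha₀
  refine ⟨z, fun j hj => ?_, abs_det_submatrix_mul_transpose_mulVec_le hD hva⟩
  have hTg : ∀ i ∈ T ∩ Set.range g, (Aᵀ *ᵥ (z - y)) i = 0 := by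
    rintro _ ⟨hk, k, rfl⟩
    rw [Matrix.mulVec_sub, Pi.sub_apply, hz, sub_eq_zero]
    exact if_pos hk
  have hker : Submodule.span 𝕜 (A.col '' (T ∩ Set.range g)) ≤
      LinearMap.ker (dotProductEquiv 𝕜 ι (z - y)) := by
    refine Submodule.span_le.mpr ?_
    rintro _ ⟨i, hi, rfl⟩
    exact (dotProduct_comm _ _).trans (hTg i hi)
  have hzero : (Aᵀ *ᵥ (z - y)) j = 0 :=
    (dotProduct_comm _ _).trans (hker (hg.col_mem_span j hj))
  rwa [Matrix.mulVec_sub, Pi.sub_apply, sub_eq_zero] at hzero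

end Repair

theorem dotProduct_eq_zero_of_mul_eq_zero {ι R : Type*} [Fintype ι] [Semiring R] [NoZeroDivisors R]
    {x x' s : ι → R} (h : ∀ j, x j * s j = 0) (hx : ∀ j, x j = 0 → x' j = 0) : x' ⬝ᵥ s = 0 :=
  Finset.sum_eq_zero fun j _ => (mul_eq_zero.mp (h j)).elim
    (fun hj => by rw [hx j hj, zero_mul]) fun hj => by rw [hj, mul_zero]

theorem eq_zero_of_dotProduct_eq_zero_of_pos {ι R : Type*} [Fintype ι] [Semiring R]
    [PartialOrder R] [IsOrderedRing R] [NoZeroDivisors R] {w s : ι → R} (hw : 0 ≤ w)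
    (hs : ∀ j, 0 < s j) (h : w ⬝ᵥ s = 0) : w = 0 := by
  funext j
  have hj := (Finset.sum_eq_zero_iff_of_nonneg fun j _ => mul_nonneg (hw j) (hs j).le).mp h j
    (Finset.mem_univ j)
  exact (mul_eq_zero.mp hj).resolve_right (hs j).ne'

namespace LO

variable {m n : ℕ} {P : LO m n} {p q : (Fin n → ℝ) × (Fin m → ℝ) × (Fin n → ℝ)}

theorem mul_eq_zero_of_mem_optimalSet_of_mem_optimalSet (hp : p ∈ P.optimalSet)
    (hq : q ∈ P.optimalSet) (i : Fin n) : p.1 i * q.2.2 i = 0 := by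
  have hpq : ∀ i, 0 ≤ p.1 i * q.2.2 i := fun i => mul_nonneg (hp.1.2.2.1 i) (hq.1.2.2.2 i)
  have hqp : ∀ i, 0 ≤ q.1 i * p.2.2 i := fun i => mul_nonneg (hq.1.2.2.1 i) (hp.1.2.2.2 i)
  have horth : (p.1 - q.1) ⬝ᵥ (p.2.2 - q.2.2) = 0 :=
    dotProduct_sub_eq_zero hp.1.1 hq.1.1 hp.1.2.1 hq.1.2.1
  have hsum : ∑ i, (p.1 i * q.2.2 i + q.1 i * p.2.2 i) = 0 := by
    rw [← neg_eq_zero, ← horth, ← Finset.sum_neg_distrib]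
    refine Finset.sum_congr rfl fun i _ => ?_
    rw [Pi.sub_apply, Pi.sub_apply]
    linear_combination -mul_eq_zero_of_mem_optimalSet hp i - mul_eq_zero_of_mem_optimalSet hq i
  have hi := (Finset.sum_eq_zero_iff_of_nonneg fun j _ => add_nonneg (hpq j) (hqp j)).mp hsum i
    (Finset.mem_univ i)
  exact ((add_eq_zero_iff_of_nonneg (hpq i) (hqp i)).mp hi).1

theorem slack_eq_zero_of_mem_partitionB (hp : p ∈ P.optimalSet) {i : Fin n}
    (hi : i ∈ P.partitionB) : p.2.2 i = 0 := by
  obtain ⟨q, hq, hqi⟩ := hi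
  exact (mul_eq_zero.mp (mul_eq_zero_of_mem_optimalSet_of_mem_optimalSet hq hp i)).resolve_left
    hqi.ne'

theorem primal_eq_zero_of_mem_partitionN (hp : p ∈ P.optimalSet) {i : Fin n}
    (hi : i ∈ P.partitionN) : p.1 i = 0 := by
  obtain ⟨q, hq, hqi⟩ := hi
  exact (mul_eq_zero.mp (mul_eq_zero_of_mem_optimalSet_of_mem_optimalSet hp hq i)).resolve_right
    hqi.ne'

theorem exists_optimal_primal_vertex {y₀ : Fin m → ℝ} {s₀ : Fin n → ℝ}
    (hdual : P.Aᵀ *ᵥ y₀ + s₀ = P.c) (hs₀ : ∀ i, 0 < s₀ i) (hp : p ∈ P.optimalSet) (i : Fin n) :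
    ∃ x, (x, p.2) ∈ P.optimalSet ∧ p.1 i ≤ x i ∧ LinearIndepOn ℝ P.A.col {j | x j ≠ 0} := by
  have hcomp := mul_eq_zero_of_mem_optimalSet hp
  obtain ⟨x, hxW, hx₀, hxp, hxi, hmin⟩ := exists_minimal_support
    (LinearMap.ker (Matrix.mulVecLin P.A)) i p.1 hp.1.2.2.1 (by
      intro w (hw : P.A *ᵥ w = 0) hw₀ hsupp
      have hcost : w ⬝ᵥ P.c = 0 := by
        rw [← hp.1.2.1, dotProduct_add, dotProduct_transpose_mulVec_eq_zero hw,
          dotProduct_eq_zero_of_mul_eq_zero hcomp hsupp, add_zero]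
      rw [← hdual, dotProduct_add, dotProduct_transpose_mulVec_eq_zero hw, zero_add] at hcost
      exact eq_zero_of_dotProduct_eq_zero_of_pos hw₀ hs₀ hcost)
  have hAx : P.A *ᵥ (x - p.1) = 0 := hxW
  rw [Matrix.mulVec_sub, hp.1.1, sub_eq_zero] at hAx
  refine ⟨x, ⟨⟨hAx, hp.1.2.1, hx₀, hp.1.2.2.2⟩, dotProduct_eq_zero_of_mul_eq_zero hcomp hxp⟩, hxi,
    linearIndepOn_col_iff.mpr fun u hu hAu => hmin u hAu fun j hj => hu j ?_⟩
  simpa using hj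

theorem exists_optimal_dual_vertex (hA : P.A.rank = m) {x₀ : Fin n → ℝ} (hAx₀ : P.A *ᵥ x₀ = P.b)
    (hx₀ : ∀ i, 0 < x₀ i) (hp : p ∈ P.optimalSet) (j : Fin n) :
    ∃ y s, (p.1, y, s) ∈ P.optimalSet ∧ p.2.2 j ≤ s j ∧
      Submodule.span ℝ (P.A.col '' {i | s i = 0}) = ⊤ := by
  have hcomp : ∀ i, p.2.2 i * p.1 i = 0 := fun i =>
    (mul_comm _ _).trans (mul_eq_zero_of_mem_optimalSet hp i)
  obtain ⟨s, ⟨v, hv⟩, hs₀, hsp, hsj, hmin⟩ := exists_minimal_support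
    (LinearMap.range (Matrix.mulVecLin P.Aᵀ)) j p.2.2 hp.1.2.2.2 (by
      rintro _ ⟨v, rfl⟩ hw₀ hsupp
      have horth : (p.1 - x₀) ⬝ᵥ (P.Aᵀ *ᵥ v) = 0 :=
        dotProduct_transpose_mulVec_eq_zero (by rw [Matrix.mulVec_sub, hp.1.1, hAx₀, sub_self]) v
      refine eq_zero_of_dotProduct_eq_zero_of_pos hw₀ hx₀ ?_
      rw [dotProduct_comm, ← neg_eq_zero, ← horth, sub_dotProduct, dotProduct_comm p.1,
        ← Matrix.mulVecLin_apply, dotProduct_eq_zero_of_mul_eq_zero hcomp hsupp, zero_sub])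
  rw [Matrix.mulVecLin_apply] at hv
  have hdual : P.Aᵀ *ᵥ (p.2.1 - v) + s = P.c := by
    rw [Matrix.mulVec_sub, hv, ← hp.1.2.1]
    abel
  refine ⟨p.2.1 - v, s, ⟨⟨hp.1.1, hdual, hp.1.2.2.1, hs₀⟩, ?_⟩, hsj, ?_⟩
  · exact (dotProduct_comm _ _).trans (dotProduct_eq_zero_of_mul_eq_zero hcomp hsp)
  · exact span_col_image_eq_top fun u hu =>
      eq_zero_of_transpose_mulVec_eq_zero (by rw [hA, Fintype.card_fin]) (hmin _ ⟨u, rfl⟩ hu)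

end LO

section Integrality

variable {ι κ R : Type*} [Fintype ι] [DecidableEq ι] [CommRing R] [LinearOrder R]
  [IsStrictOrderedRing R]

theorem one_le_abs_of_eq_intCast {r : R} {z : ℤ} (hz : r = z) (hr : r ≠ 0) : 1 ≤ |r| := by
  rw [hz, ← Int.cast_abs, ← Int.cast_one, Int.cast_le]
  exact Int.one_le_abs fun h => hr (by rw [hz, h, Int.cast_zero])

omit [LinearOrder R] [IsStrictOrderedRing R] in
theorem det_submatrix_map_intCast (A : Matrix ι κ ℤ) (g : ι → κ) :
    ((A.map ((↑) : ℤ → R)).submatrix id g).det = (A.submatrix id g).det := by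
  rw [Int.cast_det]
  rfl

theorem one_le_abs_det_submatrix_mul_apply [Fintype κ] {A : Matrix ι κ ℤ} {b : ι → ℤ} {g : ι → κ}
    (hdet : ((A.map ((↑) : ℤ → R)).submatrix id g).det ≠ 0) {x : κ → R}
    (hAx : A.map ((↑) : ℤ → R) *ᵥ x = fun i => (b i : R)) (hx : ∀ j, j ∉ Set.range g → x j = 0)
    {j : κ} (hj : x j ≠ 0) :
    1 ≤ |((A.map ((↑) : ℤ → R)).submatrix id g).det * x j| := by
  obtain ⟨k, rfl⟩ : j ∈ Set.range g := not_imp_comm.mp (hx j) hj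
  refine one_le_abs_of_eq_intCast (z := ((A.submatrix id g).updateCol k b).det) ?_
    (mul_ne_zero hdet hj)
  rw [det_submatrix_mul_apply _ (injective_of_det_submatrix_ne_zero hdet) hx, hAx,
    Matrix.cramer_apply, Int.cast_det]
  congr 1
  ext i l
  rcases eq_or_ne l k with rfl | hl
  · simp
  · simp [hl]

theorem one_le_abs_det_submatrix_mul_slack {A : Matrix ι κ ℤ} {c : κ → ℤ} {g : ι → κ}
    (hdet : ((A.map ((↑) : ℤ → R)).submatrix id g).det ≠ 0) {y : ι → R} {s : κ → R}
    (hdual : (A.map ((↑) : ℤ → R))ᵀ *ᵥ y + s = fun j => (c j : R)) (hs : ∀ k, s (g k) = 0) {j : κ}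
    (hj : s j ≠ 0) : 1 ≤ |((A.map ((↑) : ℤ → R)).submatrix id g).det * s j| := by
  refine one_le_abs_of_eq_intCast (z := (A.submatrix id g).det * c j -
    ∑ k, c (g k) * (A.submatrix id (Function.update g k j)).det) ?_ (mul_ne_zero hdet hj)
  have hy := det_submatrix_mul_transpose_mulVec (A.map ((↑) : ℤ → R)) g y j
  simp only [eq_sub_of_add_eq hdual, Pi.sub_apply, hs, sub_zero, det_submatrix_map_intCast] at hy
  rw [det_submatrix_map_intCast]
  simp only [Int.cast_sub, Int.cast_mul, Int.cast_sum]
  linear_combination -hy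

end Integrality

/-! ### Rounding to an optimal solution -/

section LeastSquares

variable {ι : Type*} [Fintype ι]

theorem exists_isMinOn_l2norm_sub {S : Set (ι → ℝ)} (hS : IsClosed S) (hne : S.Nonempty)
    (a : ι → ℝ) : ∃ u ∈ S, IsMinOn (fun v => l2norm (v - a)) S u := by
  have hS' : IsClosed ((fun v : EuclideanSpace ℝ ι => v.ofLp) ⁻¹' S) :=
    hS.preimage (PiLp.continuous_ofLp 2 _)
  obtain ⟨v₀, hv₀⟩ := hne
  obtain ⟨u, hu, hmin⟩ := hS'.exists_infDist_eq_dist ⟨WithLp.toLp 2 v₀, hv₀⟩ (WithLp.toLp 2 a)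
  refine ⟨u.ofLp, hu, isMinOn_iff.mpr fun v hv => ?_⟩
  have hle := Metric.infDist_le_dist_of_mem (x := WithLp.toLp 2 a)
    (show WithLp.toLp 2 v ∈ (fun v : EuclideanSpace ℝ ι => v.ofLp) ⁻¹' S from hv)
  rwa [hmin, dist_comm, dist_eq_norm, dist_comm, dist_eq_norm] at hle

/-- Least squares moves no entry in `T` by more than `Fintype.card ι` times the largest change that
the competitor `v` makes there, because the entries outside `T` contribute equally. -/
theorem abs_sub_le_of_l2norm_sub_le {u v a : ι → ℝ} {T : Set ι} (hu : ∀ j ∉ T, u j = 0)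
    (hv : ∀ j ∉ T, v j = 0) (h : l2norm (u - a) ≤ l2norm (v - a)) {e : ℝ}
    (he : ∀ j ∈ T, |v j - a j| ≤ e) {i : ι} (hi : i ∈ T) : |u i - a i| ≤ Fintype.card ι * e := by
  have he₀ : 0 ≤ e := (abs_nonneg _).trans (he i hi)
  have hsq : ∑ j, (u j - a j) ^ 2 ≤ ∑ j, (v j - a j) ^ 2 := by
    have hsq := pow_le_pow_left₀ (l2norm_nonneg _) h 2
    rwa [l2norm_sq, l2norm_sq] at hsq
  have hle : l2norm (T.indicator (u - a)) ≤ l2norm (T.indicator (v - a)) := by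
    refine l2norm_le_of_sum_sq_le (l2norm_nonneg _) ?_
    rw [l2norm_sq, ← sub_nonneg, ← Finset.sum_sub_distrib]
    rw [← sub_nonneg, ← Finset.sum_sub_distrib] at hsq
    refine hsq.trans_eq (Finset.sum_congr rfl fun j _ => ?_)
    by_cases hj : j ∈ T
    · simp [hj]
    · simp [hj, hu j hj, hv j hj]
  calc |u i - a i| = |T.indicator (u - a) i| := by rw [Set.indicator_of_mem hi, Pi.sub_apply]
    _ ≤ l2norm (T.indicator (u - a)) := abs_apply_le_l2norm _ _
    _ ≤ ∑ j, |T.indicator (v - a) j| := hle.trans (l2norm_le_sum_abs _)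
    _ ≤ ∑ _j : ι, e := Finset.sum_le_sum fun j _ => by
        by_cases hj : j ∈ T
        · simpa [hj] using he j hj
        · simpa [hj] using he₀
    _ = Fintype.card ι * e := by simp

theorem pos_of_l2norm_sub_le {u v a : ι → ℝ} {T : Set ι} (hu : ∀ j ∉ T, u j = 0)
    (hv : ∀ j ∉ T, v j = 0) (h : l2norm (u - a) ≤ l2norm (v - a)) {d E : ℝ} (hd : 0 < d)
    (hE : ∀ j ∈ T, d * |v j - a j| ≤ E) {i : ι} (hi : i ∈ T)
    (hEi : Fintype.card ι * E < d * a i) :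
    0 < u i := by
  have hclose := abs_sub_le_of_l2norm_sub_le hu hv h
    (fun j hj => (le_div_iff₀' hd).mpr (hE j hj)) hi
  have hlt : Fintype.card ι * (E / d) < a i := by rwa [← mul_div_assoc, div_lt_iff₀' hd]
  linarith [(abs_le.mp hclose).1]

end LeastSquares

namespace IntLO

variable {m n : ℕ}

/-- What the algorithm knows about its last iterate `(x, y, s)` for the integer problem `I`: up to
a slack error `ρ` it is a feasible pair near the central path with parameter `μ`, and it has a
small gap to every optimal solution. The numbers `D` and `Λ` bound the minors of `A` and the
reciprocal of the rounding threshold. -/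
structure IsNearlyOptimal (I : IntLO m n) (Λ D μ : ℝ) (x : Fin n → ℝ) (y : Fin m → ℝ)
    (s ρ : Fin n → ℝ) : Prop where
  n_pos : 0 < n
  rank_eq : I.toLO.A.rank = m
  exists_dual_pos : ∃ (y₀ : Fin m → ℝ) (s₀ : Fin n → ℝ),
    I.toLO.Aᵀ *ᵥ y₀ + s₀ = I.toLO.c ∧ ∀ i, 0 < s₀ i
  exists_strictly_complementary : ∃ p ∈ I.toLO.optimalSet, ∀ i, 0 < p.1 i ∨ 0 < p.2.2 i
  mulVec_eq : I.toLO.A *ᵥ x = I.toLO.b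
  dual_eq : I.toLO.Aᵀ *ᵥ y + s = I.toLO.c + ρ
  primal_pos : ∀ i, 0 < x i
  slack_pos : ∀ i, 0 < s i
  mu_pos : 0 < μ
  half_mu_lt : ∀ i, μ / 2 < x i * s i
  gap_le : ∀ p ∈ I.toLO.optimalSet, ∑ i, (x i * p.2.2 i + p.1 i * s i) ≤ 7 / 4 * n * μ
  four_le : 4 ≤ Λ
  mu_mul_le : μ * Λ ^ 2 ≤ 1
  abs_error_le : ∀ i, |ρ i| ≤ (Λ ^ 4)⁻¹
  abs_det_le : ∀ g : Fin m → Fin n, |(I.toLO.A.submatrix id g).det| ≤ D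
  minor_bound_le : 4 * n ^ 2 * D ≤ Λ

namespace IsNearlyOptimal

variable {I : IntLO m n} {Λ D μ : ℝ} {x s ρ : Fin n → ℝ} {y : Fin m → ℝ}
  (h : I.IsNearlyOptimal Λ D μ x y s ρ)

include h

theorem Λ_pos : 0 < Λ := by linarith [h.four_le]

theorem one_le_n : (1 : ℝ) ≤ n := by exact_mod_cast h.n_pos

theorem minor_bound_nonneg : 0 ≤ D := (abs_nonneg _).trans (h.abs_det_le fun _ => ⟨0, h.n_pos⟩)

theorem four_mul_le : 4 * n * D ≤ Λ := by
  have hD := h.minor_bound_nonneg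
  refine le_trans ?_ h.minor_bound_le
  gcongr
  exact le_self_pow₀ h.one_le_n two_ne_zero

theorem mul_le_of_mem_optimalSet {p : (Fin n → ℝ) × (Fin m → ℝ) × (Fin n → ℝ)}
    (hp : p ∈ I.toLO.optimalSet) (i : Fin n) :
    x i * p.2.2 i ≤ 7 / 4 * n * μ ∧ s i * p.1 i ≤ 7 / 4 * n * μ := by
  have hx : ∀ i, 0 ≤ x i * p.2.2 i := fun i => mul_nonneg (h.primal_pos i).le (hp.1.2.2.2 i)
  have hs : ∀ i, 0 ≤ p.1 i * s i := fun i => mul_nonneg (hp.1.2.2.1 i) (h.slack_pos i).le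
  have hsum := (Finset.single_le_sum (fun i _ => add_nonneg (hx i) (hs i))
    (Finset.mem_univ i)).trans (h.gap_le p hp)
  rw [mul_comm (s i)]
  exact ⟨(le_add_of_nonneg_right (hs i)).trans hsum, (le_add_of_nonneg_left (hx i)).trans hsum⟩

theorem le_and_lt_of_one_le_mul {u v w d : ℝ} (hu : 0 < u) (hv : 0 < v) (huv : μ / 2 < u * v)
    (hgap : v * w ≤ 7 / 4 * n * μ) (hd : 0 ≤ d) (hdD : d ≤ D) (hw : 1 ≤ d * w) :
    v ≤ 7 / 4 * n * μ * D ∧ 2 < 7 * n * (d * u) := by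
  have hμ := h.mu_pos
  have hvd : v ≤ 7 / 4 * n * μ * d := by
    calc v ≤ v * (d * w) := le_mul_of_one_le_right hv.le hw
      _ = v * w * d := by ring
      _ ≤ 7 / 4 * n * μ * d := by gcongr
  have hlt : μ * 2 < μ * (7 * n * (d * u)) := by
    have hle : u * v ≤ u * (7 / 4 * n * μ * d) := by gcongr
    linarith
  exact ⟨hvd.trans (by gcongr), lt_of_mul_lt_mul_left hlt hμ.le⟩

theorem exists_primal_basis {i : Fin n} (hi : i ∈ I.toLO.partitionB) :
    ∃ g, SelectsBasis I.toLO.A I.toLO.partitionB g ∧ s i ≤ 7 / 4 * n * μ * D ∧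
      2 < 7 * n * (|(I.toLO.A.submatrix id g).det| * x i) := by
  obtain ⟨y₀, s₀, hdual, hs₀⟩ := h.exists_dual_pos
  obtain ⟨p, hp, hpi⟩ := hi
  obtain ⟨z, hz, hzi, hli⟩ := LO.exists_optimal_primal_vertex hdual hs₀ hp i
  have hzpos : 0 < z i := hpi.trans_le hzi
  have hsupp : {j | z j ≠ 0} ⊆ I.toLO.partitionB := fun j hj =>
    ⟨_, hz, (hz.1.2.2.1 j).lt_of_ne' hj⟩
  obtain ⟨g, hg, hzg, -⟩ := exists_selectsBasis hli hsupp (Set.subset_univ _)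
    (span_col_image_eq_top fun v hv => eq_zero_of_transpose_mulVec_eq_zero
      (by rw [h.rank_eq, Fintype.card_fin]) (funext fun j => hv j (Set.mem_univ j)))
  have hone : 1 ≤ |(I.toLO.A.submatrix id g).det * z i| :=
    one_le_abs_det_submatrix_mul_apply hg.det_ne_zero hz.1.1
      (fun j hj => not_imp_comm.mp (fun hj => hzg hj) hj) hzpos.ne'
  rw [abs_mul, abs_of_pos hzpos] at hone
  exact ⟨g, hg, h.le_and_lt_of_one_le_mul (h.primal_pos i) (h.slack_pos i) (h.half_mu_lt i)
    (h.mul_le_of_mem_optimalSet hz i).2 (abs_nonneg _) (h.abs_det_le g) hone⟩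

theorem exists_dual_basis {i : Fin n} (hi : i ∈ I.toLO.partitionN) :
    ∃ g, SelectsBasis I.toLO.A I.toLO.partitionB g ∧ x i ≤ 7 / 4 * n * μ * D ∧
      2 < 7 * n * (|(I.toLO.A.submatrix id g).det| * s i) := by
  obtain ⟨p, hp, hpi⟩ := hi
  obtain ⟨v, w, hw, hwi, hspan⟩ :=
    LO.exists_optimal_dual_vertex h.rank_eq h.mulVec_eq h.primal_pos hp i
  have hwpos : 0 < w i := hpi.trans_le hwi
  obtain ⟨g, hg, -, hgw⟩ := exists_selectsBasis (linearIndepOn_empty ℝ I.toLO.A.col)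
    (Set.empty_subset _) (fun j hj => LO.slack_eq_zero_of_mem_partitionB hw hj) hspan
  have hone : 1 ≤ |(I.toLO.A.submatrix id g).det * w i| :=
    one_le_abs_det_submatrix_mul_slack hg.det_ne_zero hw.1.2.1 hgw hwpos.ne'
  rw [abs_mul, abs_of_pos hwpos] at hone
  exact ⟨g, hg, h.le_and_lt_of_one_le_mul (h.slack_pos i) (h.primal_pos i)
    ((h.half_mu_lt i).trans_eq (mul_comm _ _)) (h.mul_le_of_mem_optimalSet hw i).1 (abs_nonneg _)
    (h.abs_det_le g) hone⟩

theorem mem_partitionN_iff {i : Fin n} : i ∈ I.toLO.partitionN ↔ i ∉ I.toLO.partitionB := by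
  obtain ⟨p, hp, hpos⟩ := h.exists_strictly_complementary
  refine ⟨fun hN hB => ?_, fun hB => ⟨p, hp, (hpos i).resolve_left fun hi => hB ⟨p, hp, hi⟩⟩⟩
  rcases hpos i with hi | hi
  · exact hi.ne' (LO.primal_eq_zero_of_mem_partitionN hp hN)
  · exact hi.ne' (LO.slack_eq_zero_of_mem_partitionB hp hB)

theorem small_lt_inv : 7 / 4 * n * μ * D < Λ⁻¹ := by
  have hμ := h.mu_pos
  have hΛ := h.Λ_pos
  rw [← one_div, lt_div_iff₀ hΛ]
  calc 7 / 4 * n * μ * D * Λ = 7 / 16 * (4 * n * D) * (μ * Λ) := by ring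
    _ ≤ 7 / 16 * Λ * (μ * Λ) := by gcongr; exact h.four_mul_le
    _ = 7 / 16 * (μ * Λ ^ 2) := by ring
    _ < 1 := by linarith [h.mu_mul_le]

theorem inv_le_of_two_lt {g : Fin m → Fin n} {u : ℝ} (hu : 0 < u)
    (hlt : 2 < 7 * n * (|(I.toLO.A.submatrix id g).det| * u)) : Λ⁻¹ ≤ u := by
  rw [← one_div, div_le_iff₀' h.Λ_pos]
  have hdet : n * (|(I.toLO.A.submatrix id g).det| * u) ≤ n * (D * u) := by
    gcongr
    exact h.abs_det_le g
  have hΛ := mul_le_mul_of_nonneg_right h.four_mul_le hu.le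
  linarith

theorem slack_lt_inv_iff {i : Fin n} : s i < Λ⁻¹ ↔ i ∈ I.toLO.partitionB := by
  refine ⟨fun hlt => not_not.mp fun hB => ?_,
    fun hi => ?_⟩
  · obtain ⟨g, -, -, hg⟩ := h.exists_dual_basis (h.mem_partitionN_iff.mpr hB)
    exact (h.inv_le_of_two_lt (h.slack_pos i) hg).not_gt hlt
  · obtain ⟨g, -, hle, -⟩ := h.exists_primal_basis hi
    exact hle.trans_lt h.small_lt_inv

theorem primal_lt_inv_iff {i : Fin n} : x i < Λ⁻¹ ↔ i ∈ I.toLO.partitionN := by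
  refine ⟨fun hlt => h.mem_partitionN_iff.mpr fun hi => ?_,
    fun hi => ?_⟩
  · obtain ⟨g, -, -, hg⟩ := h.exists_primal_basis hi
    exact (h.inv_le_of_two_lt (h.primal_pos i) hg).not_gt hlt
  · obtain ⟨g, -, hle, -⟩ := h.exists_dual_basis hi
    exact hle.trans_lt h.small_lt_inv

theorem exists_isRounding : ∃ p, I.toLO.IsRounding Λ⁻¹ x s p := by
  obtain ⟨p, hp, -⟩ := h.exists_strictly_complementary
  have hclosed : ∀ v : Fin n → ℝ, IsClosed {w : Fin n → ℝ | ∀ i, v i < Λ⁻¹ → w i = 0} := fun v => by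
    simp only [Set.ofPred_forall]
    exact isClosed_iInter fun i => isClosed_iInter fun _ =>
      isClosed_eq (continuous_apply i) continuous_const
  obtain ⟨u, hu, humin⟩ := exists_isMinOn_l2norm_sub (S := I.toLO.roundedPrimal Λ⁻¹ x)
    (IsClosed.inter (isClosed_eq (by fun_prop) continuous_const) (hclosed x))
    ⟨p.1, hp.1.1, fun i hi => LO.primal_eq_zero_of_mem_partitionN hp (h.primal_lt_inv_iff.mp hi)⟩ x
  obtain ⟨w, ⟨⟨z, hz⟩, hw⟩, hwmin⟩ := exists_isMinOn_l2norm_sub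
    (S := {w | I.toLO.c - w ∈ LinearMap.range (Matrix.mulVecLin I.toLO.Aᵀ)} ∩
      {w | ∀ i, s i < Λ⁻¹ → w i = 0})
    (IsClosed.inter ((Submodule.closed_of_finiteDimensional
      (LinearMap.range (Matrix.mulVecLin I.toLO.Aᵀ))).preimage (by fun_prop)) (hclosed s))
    ⟨p.2.2, ⟨p.2.1, eq_sub_of_add_eq hp.1.2.1⟩,
      fun i hi => LO.slack_eq_zero_of_mem_partitionB hp (h.slack_lt_inv_iff.mp hi)⟩ s
  rw [Matrix.mulVecLin_apply] at hz
  exact ⟨(u, z, w), ⟨hu, humin⟩, ⟨by rw [hz, sub_add_cancel], hw⟩,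
    fun q hq => hwmin (show q.2 ∈ _ from ⟨⟨q.1, eq_sub_of_add_eq hq.1⟩, hq.2⟩)⟩

theorem n_pow_mul_le : n ^ 4 * μ * D ^ 2 ≤ 1 / 16 := by
  have hD := h.minor_bound_nonneg
  have hsq : (4 * n ^ 2 * D) ^ 2 ≤ Λ ^ 2 := by
    gcongr
    exact h.minor_bound_le
  linarith [mul_le_mul_of_nonneg_left hsq h.mu_pos.le, h.mu_mul_le]

theorem n_pow_three_mul_le {g : Fin m → Fin n}
    (hg : SelectsBasis I.toLO.A I.toLO.partitionB g) : n ^ 3 * D * (Λ ^ 4)⁻¹ ≤ 1 / 256 := by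
  have hn := h.one_le_n
  have hΛ := h.Λ_pos
  have hD : 1 ≤ D := (one_le_abs_of_eq_intCast (det_submatrix_map_intCast I.A g)
    hg.det_ne_zero).trans (h.abs_det_le g)
  have hnΛ : n ≤ Λ / 4 := by
    nlinarith [h.four_mul_le]
  have hnD : n ^ 2 * D ≤ Λ / 4 := by linarith [h.minor_bound_le]
  have hcube : n ^ 3 * D ≤ Λ ^ 2 / 16 := by
    calc n ^ 3 * D = n * (n ^ 2 * D) := by ring
      _ ≤ Λ / 4 * (Λ / 4) := by gcongr
      _ = Λ ^ 2 / 16 := by ring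
  have hsq : 4 ^ 2 ≤ Λ ^ 2 := pow_le_pow_left₀ (by norm_num) h.four_le 2
  rw [mul_inv_le_iff₀ (by positivity)]
  nlinarith

theorem exists_mem_roundedPrimal {g : Fin m → Fin n}
    (hg : SelectsBasis I.toLO.A I.toLO.partitionB g) :
    ∃ v ∈ I.toLO.roundedPrimal Λ⁻¹ x, ∀ j ∈ I.toLO.partitionB,
      |(I.toLO.A.submatrix id g).det| * |v j - x j| ≤ n * (7 / 4 * n * μ * D * D) := by
  obtain ⟨p, hp, -⟩ := h.exists_strictly_complementary
  have hsmall : 0 ≤ 7 / 4 * n * μ * D := by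
    have := h.minor_bound_nonneg
    have := h.mu_pos
    positivity
  let w : Fin n → ℝ := I.toLO.partitionBᶜ.indicator x
  have hwB : ∀ j ∈ I.toLO.partitionB, w j = 0 := fun j hj =>
    Set.indicator_of_notMem (Set.notMem_compl_iff.mpr hj) x
  have hwN : ∀ j ∉ I.toLO.partitionB, w j = x j := fun j hj => Set.indicator_of_mem hj x
  have hAw : I.toLO.A *ᵥ (p.1 - (x - w)) = I.toLO.A *ᵥ w := by
    rw [Matrix.mulVec_sub, Matrix.mulVec_sub, hp.1.1, h.mulVec_eq, sub_sub_cancel]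
  have hsupp : ∀ j ∉ I.toLO.partitionB, (p.1 - (x - w)) j = 0 := fun j hj => by
    simp [hwN j hj, LO.primal_eq_zero_of_mem_partitionN hp (h.mem_partitionN_iff.mpr hj)]
  have hwle : ∀ j, |w j| ≤ 7 / 4 * n * μ * D := fun j => by
    by_cases hj : j ∈ I.toLO.partitionB
    · rwa [hwB j hj, abs_zero]
    · obtain ⟨-, -, hle, -⟩ := h.exists_dual_basis (h.mem_partitionN_iff.mpr hj)
      rwa [hwN j hj, abs_of_pos (h.primal_pos j)]
  obtain ⟨v, hv, hvB, hvle⟩ := hg.exists_mulVec_eq h.abs_det_le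
    (mem_span_col_image.mpr ⟨_, hsupp, hAw⟩) hwle hsmall
  refine ⟨x - w + v, ⟨?_, fun j hj => ?_⟩, fun j hj => ?_⟩
  · rw [Matrix.mulVec_add, Matrix.mulVec_sub, h.mulVec_eq, hv, sub_add_cancel]
  · have hjB := h.mem_partitionN_iff.mp (h.primal_lt_inv_iff.mp hj)
    simp [hwN j hjB, hvB j hjB]
  · simpa [hwB j hj] using hvle j

theorem exists_mem_roundedDual {g : Fin m → Fin n}
    (hg : SelectsBasis I.toLO.A I.toLO.partitionB g) :
    ∃ q ∈ I.toLO.roundedDual Λ⁻¹ s, ∀ j, |(I.toLO.A.submatrix id g).det| * |q.2 j - s j| ≤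
      D * (Λ ^ 4)⁻¹ + n * ((7 / 4 * n * μ * D + (Λ ^ 4)⁻¹) * D) := by
  obtain ⟨p, hp, -⟩ := h.exists_strictly_complementary
  have hD := h.minor_bound_nonneg
  have hμ := h.mu_pos
  have hΛ := h.Λ_pos
  have hexact : I.toLO.Aᵀ *ᵥ y + (s - ρ) = I.toLO.c := by
    rw [add_sub, h.dual_eq, add_sub_cancel_right]
  have hsub : I.toLO.Aᵀ *ᵥ (p.2.1 - y) = s - ρ - p.2.2 := by
    rw [Matrix.mulVec_sub, eq_sub_of_add_eq hp.1.2.1, eq_sub_of_add_eq hexact,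
      sub_sub_sub_cancel_left]
  have hB : ∀ j ∈ I.toLO.partitionB, (I.toLO.Aᵀ *ᵥ (p.2.1 - y)) j = s j - ρ j := fun j hj => by
    simp [hsub, LO.slack_eq_zero_of_mem_partitionB hp hj]
  obtain ⟨z, hz, hzle⟩ := hg.exists_transpose_mulVec_eq h.abs_det_le
    (a := 7 / 4 * n * μ * D + (Λ ^ 4)⁻¹) (fun j hj => by
      obtain ⟨-, -, hle, -⟩ := h.exists_primal_basis hj
      rw [hB j hj]
      refine (abs_sub _ _).trans (add_le_add ?_ (h.abs_error_le j))
      rwa [abs_of_pos (h.slack_pos j)]) (by positivity)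
  have hmn : (m : ℝ) ≤ n := by
    exact_mod_cast h.rank_eq ▸ I.toLO.A.rank_le_width
  refine ⟨(y + z, s - ρ - I.toLO.Aᵀ *ᵥ z), ⟨?_, fun j hj => ?_⟩, fun j => ?_⟩
  · rw [Matrix.mulVec_add, add_add_sub_cancel, hexact]
  · have hjB := h.slack_lt_inv_iff.mp hj
    simp [hz j hjB, hB j hjB]
  · calc |(I.toLO.A.submatrix id g).det| * |s j - ρ j - (I.toLO.Aᵀ *ᵥ z) j - s j|
        = |(I.toLO.A.submatrix id g).det| * |ρ j + (I.toLO.Aᵀ *ᵥ z) j| := by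
          rw [← abs_neg (ρ j + _)]
          ring_nf
      _ ≤ |(I.toLO.A.submatrix id g).det| * |ρ j| +
          |(I.toLO.A.submatrix id g).det| * |(I.toLO.Aᵀ *ᵥ z) j| := by
          rw [← mul_add]
          gcongr
          exact abs_add_le _ _
      _ ≤ D * (Λ ^ 4)⁻¹ + n * ((7 / 4 * n * μ * D + (Λ ^ 4)⁻¹) * D) := by
          refine add_le_add (mul_le_mul (h.abs_det_le g) (h.abs_error_le j) (abs_nonneg _) hD)
            ((hzle j).trans ?_)
          rw [Fintype.card_fin]
          gcongr

theorem primal_pos_of_mem_partitionB {u : Fin n → ℝ} (hu : u ∈ I.toLO.roundedPrimal Λ⁻¹ x)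
    (hmin : IsMinOn (fun v => l2norm (v - x)) (I.toLO.roundedPrimal Λ⁻¹ x) u) {i : Fin n}
    (hi : i ∈ I.toLO.partitionB) : 0 < u i := by
  obtain ⟨g, hg, -, hlt⟩ := h.exists_primal_basis hi
  obtain ⟨v, hv, hvle⟩ := h.exists_mem_roundedPrimal hg
  have hzero : ∀ w ∈ I.toLO.roundedPrimal Λ⁻¹ x, ∀ j ∉ I.toLO.partitionB, w j = 0 :=
    fun w hw j hj => hw.2 j (h.primal_lt_inv_iff.mpr (h.mem_partitionN_iff.mpr hj))
  refine pos_of_l2norm_sub_le (hzero u hu) (hzero v hv) (hmin hv) (abs_pos.mpr hg.det_ne_zero)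
    hvle hi ?_
  have hn : (0 : ℝ) < 7 * n := by linarith [h.one_le_n]
  rw [Fintype.card_fin]
  refine lt_of_mul_lt_mul_left ?_ hn.le
  linarith [h.n_pow_mul_le]

theorem slack_pos_of_mem_partitionN {q : (Fin m → ℝ) × (Fin n → ℝ)}
    (hq : q ∈ I.toLO.roundedDual Λ⁻¹ s)
    (hmin : IsMinOn (fun q => l2norm (q.2 - s)) (I.toLO.roundedDual Λ⁻¹ s) q) {i : Fin n}
    (hi : i ∈ I.toLO.partitionN) : 0 < q.2 i := by
  obtain ⟨g, hg, -, hlt⟩ := h.exists_dual_basis hi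
  obtain ⟨r, hr, hrle⟩ := h.exists_mem_roundedDual hg
  have hzero : ∀ r ∈ I.toLO.roundedDual Λ⁻¹ s, ∀ j ∉ I.toLO.partitionN, r.2 j = 0 :=
    fun r hr j hj => hr.2 j (h.slack_lt_inv_iff.mpr (not_not.mp (mt h.mem_partitionN_iff.mpr hj)))
  refine pos_of_l2norm_sub_le (hzero q hq) (hzero r hr) (hmin hr) (abs_pos.mpr hg.det_ne_zero)
    (fun j _ => hrle j) hi ?_
  have hn : (0 : ℝ) < 7 * n := by linarith [h.one_le_n]
  rw [Fintype.card_fin]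
  refine lt_of_mul_lt_mul_left ?_ hn.le
  have hsq : n ^ 2 * D * (Λ ^ 4)⁻¹ ≤ n ^ 3 * D * (Λ ^ 4)⁻¹ := by
    have hD := h.minor_bound_nonneg
    have hΛ := h.Λ_pos
    gcongr
    exacts [h.one_le_n, by norm_num]
  linarith [h.n_pow_mul_le, h.n_pow_three_mul_le hg]

theorem mem_optimalSet_of_isRounding {p : (Fin n → ℝ) × (Fin m → ℝ) × (Fin n → ℝ)}
    (hp : I.toLO.IsRounding Λ⁻¹ x s p) : p ∈ I.toLO.optimalSet := by
  obtain ⟨⟨hx, hxmin⟩, hs, hsmin⟩ := hp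
  have hxN : ∀ i ∈ I.toLO.partitionN, p.1 i = 0 := fun i hi => hx.2 i (h.primal_lt_inv_iff.mpr hi)
  have hsB : ∀ i ∈ I.toLO.partitionB, p.2.2 i = 0 := fun i hi => hs.2 i (h.slack_lt_inv_iff.mpr hi)
  have hcases : ∀ i, i ∈ I.toLO.partitionB ∨ i ∈ I.toLO.partitionN := fun i =>
    or_iff_not_imp_left.mpr h.mem_partitionN_iff.mpr
  refine ⟨⟨hx.1, hs.1, fun i => ?_, fun i => ?_⟩, Finset.sum_eq_zero fun i _ => ?_⟩ <;>
    rcases hcases i with hi | hi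
  · exact (h.primal_pos_of_mem_partitionB hx hxmin hi).le
  · exact (hxN i hi).ge
  · exact (hsB i hi).ge
  · exact (h.slack_pos_of_mem_partitionN hs hsmin hi).le
  · rw [hsB i hi, mul_zero]
  · rw [hxN i hi, zero_mul]

end IsNearlyOptimal

end IntLO

/-! ### Iteration count and input length -/

theorem count_le_of_two_rpow_lt_pow_mul {θ κ N ℓ μ₀ : ℝ} {K : ℕ} (hκ : 1 ≤ κ) (hN : 0 < N)
    (hℓ : 0 ≤ ℓ) (hμ₀ : 0 < μ₀) (hμH : μ₀ ≤ 2 ^ (κ * ℓ)) (hθ : 1 / (4 * κ * N) ≤ θ) (hθ₁ : θ ≤ 1)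
    (h : ∀ k < K, (2 : ℝ) ^ (-(2 * ℓ)) < (1 - θ) ^ k * μ₀) :
    K ≤ 1 + 14 / 5 * (κ * (κ + 2)) * (N * ℓ) := by
  rcases K with _ | k
  · rw [Nat.cast_zero]
    positivity
  have hpow : (1 - θ) ^ k ≤ Real.exp (-(θ * k)) := by
    calc (1 - θ) ^ k ≤ Real.exp (-θ) ^ k :=
          pow_le_pow_left₀ (by linarith) (Real.one_sub_le_exp_neg θ) k
      _ = Real.exp (-(θ * k)) := by rw [← Real.exp_nat_mul, mul_neg, mul_comm]
  have hexp : (2 : ℝ) ^ (-(2 * ℓ)) < Real.exp (-(θ * k)) * 2 ^ (κ * ℓ) :=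
    (h k k.lt_succ_self).trans_le (mul_le_mul hpow hμH hμ₀.le (Real.exp_pos _).le)
  rw [Real.rpow_def_of_pos two_pos, Real.rpow_def_of_pos two_pos, ← Real.exp_add,
    Real.exp_lt_exp] at hexp
  have hlog : Real.log 2 * ((κ + 2) * ℓ) ≤ 7 / 10 * ((κ + 2) * ℓ) := by
    gcongr
    linarith [Real.log_two_lt_d9]
  have hθk : θ * k ≤ 7 / 10 * ((κ + 2) * ℓ) := by linarith
  have hone : 1 ≤ 4 * κ * N * θ := by rwa [div_le_iff₀' (by positivity)] at hθ
  have hk : k ≤ 14 / 5 * (κ * (κ + 2)) * (N * ℓ) := by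
    calc (k : ℝ) ≤ 4 * κ * N * θ * k := le_mul_of_one_le_left k.cast_nonneg hone
      _ = 4 * κ * N * (θ * k) := by ring
      _ ≤ 4 * κ * N * (7 / 10 * ((κ + 2) * ℓ)) := by gcongr
      _ = 14 / 5 * (κ * (κ + 2)) * (N * ℓ) := by ring
  push_cast
  linarith

theorem mul_add_two_le_three_mul_four_rpow {κ : ℝ} (hκ : 1 ≤ κ) :
    κ * (κ + 2) ≤ 3 * 4 ^ (κ - 1) := by
  have hlog : 4 / 3 ≤ Real.log 4 := by
    rw [show (4 : ℝ) = 2 ^ 2 by norm_num, Real.log_pow, Nat.cast_two]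
    linarith [Real.log_two_gt_d9]
  have hle : 4 / 3 * (κ - 1) ≤ Real.log 4 * (κ - 1) :=
    mul_le_mul_of_nonneg_right hlog (by linarith)
  have hexp := (Real.quadratic_le_exp_of_nonneg (x := 4 / 3 * (κ - 1)) (by linarith)).trans
    (Real.exp_le_exp.mpr hle)
  rw [Real.rpow_def_of_pos (by norm_num)]
  nlinarith [sq_nonneg (κ - 1)]

theorem sq_le_two_pow {n : ℕ} (hn : 4 ≤ n) : n ^ 2 ≤ 2 ^ n := by
  induction n, hn using Nat.le_induction with
  | base => rfl
  | succ k hk ih =>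
    calc (k + 1) ^ 2 ≤ k ^ 2 * 2 := by nlinarith
      _ ≤ 2 ^ k * 2 := Nat.mul_le_mul_right 2 ih

theorem two_mul_le_two_pow (n : ℕ) : 2 * (n : ℝ) ≤ 2 ^ n := by
  exact_mod_cast Nat.mul_le_pow (by decide : 2 ≠ 1) n

theorem four_mul_sq_le_two_pow (n : ℕ) : 4 * (n : ℝ) ^ 2 ≤ 2 ^ (2 * n) := by
  calc 4 * (n : ℝ) ^ 2 = (2 * n) ^ 2 := by ring
    _ ≤ (2 ^ n) ^ 2 := pow_le_pow_left₀ (by positivity) (two_mul_le_two_pow n) 2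
    _ = 2 ^ (2 * n) := by rw [← pow_mul, mul_comm]

section GrowthFactor

variable {m n ℓ : ℕ} (hn : 0 < n) (hℓ : 2 * n ≤ ℓ) (hm : m ≠ 0 → 2 * n + 2 ≤ ℓ)

include hn hℓ hm

theorem mul_growthFactor_sq_le :
    (1 + 42 / 5 * (n * ℓ)) * (LO.growthFactor m n ^ 2 + 1) ≤ 8 ^ ℓ := by
  have hℓ2 : (4 : ℝ) ≤ 2 ^ ℓ := by
    calc (4 : ℝ) = 2 ^ 2 := by norm_num
      _ ≤ 2 ^ ℓ := pow_le_pow_right₀ one_le_two (by omega)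
  have h8 : (8 : ℝ) ^ ℓ = (2 ^ ℓ) ^ 3 := by rw [← pow_mul, mul_comm, pow_mul]; norm_num
  have hnℓ : (n : ℝ) * ℓ ≤ ℓ ^ 2 / 2 := by
    have : 2 * (n : ℝ) ≤ ℓ := by exact_mod_cast hℓ
    nlinarith
  have hn1 : (1 : ℝ) ≤ n := by exact_mod_cast hn
  rw [h8, LO.growthFactor]
  split_ifs with h
  · have hsq : (2 * (ℓ : ℝ)) ^ 2 ≤ (2 ^ ℓ) ^ 2 := by gcongr; exact two_mul_le_two_pow ℓ
    have hlin : 1 + 42 / 5 * ((n : ℝ) * ℓ) ≤ 9 / 8 * (2 ^ ℓ) ^ 2 := by nlinarith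
    calc (1 + 42 / 5 * ((n : ℝ) * ℓ)) * ((6 / 5) ^ 2 + 1)
        ≤ 9 / 8 * (2 ^ ℓ) ^ 2 * ((6 / 5) ^ 2 + 1) := by gcongr
      _ ≤ (2 ^ ℓ) ^ 2 * 2 ^ ℓ := by nlinarith
      _ = (2 ^ ℓ) ^ 3 := by ring
  · have hsq : (ℓ : ℝ) ^ 2 ≤ 2 ^ ℓ := by exact_mod_cast sq_le_two_pow (by have := hm h; omega)
    have hlin : 1 + 42 / 5 * ((n : ℝ) * ℓ) ≤ 9 / 2 * 2 ^ ℓ := by linarith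
    obtain ⟨a, rfl⟩ := Nat.exists_eq_add_of_le' (show 2 ≤ ℓ by omega)
    have hna : 4 * (n : ℝ) ≤ 2 ^ a := by
      have hle : (2 * n : ℝ) ≤ a := by exact_mod_cast show 2 * n ≤ a by have := hm h; omega
      linarith [two_mul_le_two_pow a]
    have hquad : (7 * (n : ℝ)) ^ 2 + 1 ≤ 1 / 5 * (2 ^ (a + 2)) ^ 2 := by
      have hsq : (4 * (n : ℝ)) ^ 2 ≤ (2 ^ a) ^ 2 := by gcongr
      have hone : (4 : ℝ) ^ 2 ≤ (4 * n) ^ 2 := by gcongr; linarith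
      rw [pow_add]
      linarith
    calc (1 + 42 / 5 * ((n : ℝ) * (a + 2 : ℕ))) * ((7 * (n : ℝ)) ^ 2 + 1)
        ≤ 9 / 2 * 2 ^ (a + 2) * (1 / 5 * (2 ^ (a + 2)) ^ 2) := by gcongr
      _ ≤ (2 ^ (a + 2)) ^ 3 := by
        rw [show 9 / 2 * 2 ^ (a + 2) * (1 / 5 * (2 ^ (a + 2)) ^ 2) =
          9 / 10 * ((2 : ℝ) ^ (a + 2)) ^ 3 by ring]
        exact mul_le_of_le_one_left (by positivity) (by norm_num)

theorem thirteen_mul_growthFactor_le : 13 * LO.growthFactor m n ≤ (2 ^ ℓ) ^ 2 := by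
  have hn1 : (1 : ℝ) ≤ n := by exact_mod_cast hn
  have hℓ2 : (4 : ℝ) ≤ 2 ^ ℓ := by
    calc (4 : ℝ) = 2 ^ 2 := by norm_num
      _ ≤ 2 ^ ℓ := pow_le_pow_right₀ one_le_two (by omega)
  rw [LO.growthFactor]
  split_ifs with h
  · nlinarith
  · have hpow : 16 * (n : ℝ) ≤ 2 ^ ℓ := by
      calc 16 * (n : ℝ) ≤ 4 * n ^ 2 * 2 ^ 2 := by nlinarith
        _ ≤ 2 ^ (2 * n) * 2 ^ 2 := by gcongr; exact four_mul_sq_le_two_pow n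
        _ = 2 ^ (2 * n + 2) := (pow_add _ _ _).symm
        _ ≤ 2 ^ ℓ := pow_le_pow_right₀ one_le_two (hm h)
    nlinarith

theorem mul_growthFactor_sq_le_of_le {κ k : ℝ} (hκ : 1 ≤ κ)
    (hk : k ≤ 1 + 14 / 5 * (κ * (κ + 2)) * (√n * ℓ)) :
    k * (LO.growthFactor m n ^ 2 + 1) ≤ 2 ^ (κ * ℓ) * (2 ^ (ℓ : ℝ)) ^ 2 := by
  have hn1 : (1 : ℝ) ≤ n := by exact_mod_cast hn
  have hℓ2 : (2 : ℝ) ≤ ℓ := by exact_mod_cast show 2 ≤ ℓ by omega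
  have hsqrt : √(n : ℝ) ≤ n := (Real.sqrt_le_left n.cast_nonneg).mpr (by nlinarith)
  have hpow : (4 : ℝ) ^ (κ - 1) ≤ 2 ^ ((κ - 1) * ℓ) := by
    rw [show (4 : ℝ) = 2 ^ (2 : ℝ) by norm_num, ← Real.rpow_mul zero_le_two, mul_comm]
    exact Real.rpow_le_rpow_of_exponent_le one_le_two
      (mul_le_mul_of_nonneg_left hℓ2 (by linarith))
  have hone : (1 : ℝ) ≤ 2 ^ ((κ - 1) * ℓ) :=
    Real.one_le_rpow one_le_two (mul_nonneg (by linarith) (by linarith))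
  have hsplit : (2 : ℝ) ^ (κ * ℓ) * (2 ^ (ℓ : ℝ)) ^ 2 = 2 ^ ((κ - 1) * ℓ) * 8 ^ ℓ := by
    have h8 : (8 : ℝ) ^ ℓ = (2 ^ ℓ) ^ 3 := by rw [← pow_mul, mul_comm, pow_mul]; norm_num
    rw [show κ * ℓ = (κ - 1) * ℓ + ℓ by ring, Real.rpow_add two_pos, Real.rpow_natCast, h8]
    ring
  rw [hsplit]
  set X : ℝ := 2 ^ ((κ - 1) * ℓ)
  have hkX : k ≤ X * (1 + 42 / 5 * (n * ℓ)) := by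
    have hκX : κ * (κ + 2) ≤ 3 * X := (mul_add_two_le_three_mul_four_rpow hκ).trans (by gcongr)
    have hle : 14 / 5 * (κ * (κ + 2)) * (√n * ℓ) ≤ 14 / 5 * (3 * X) * (n * ℓ) := by gcongr
    linarith
  calc k * (LO.growthFactor m n ^ 2 + 1)
      ≤ X * (1 + 42 / 5 * (n * ℓ)) * (LO.growthFactor m n ^ 2 + 1) := by gcongr
    _ = X * ((1 + 42 / 5 * (n * ℓ)) * (LO.growthFactor m n ^ 2 + 1)) := by ring
    _ ≤ X * 8 ^ ℓ := by gcongr; exact mul_growthFactor_sq_le hn hℓ hm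

end GrowthFactor

namespace IntLO

variable {m n : ℕ} (I : IntLO m n)

/-- The part of the input length that encodes the matrix `A`. -/
def matrixLength : ℕ := ∑ i, ∑ j, Nat.clog 2 ((I.A i j).natAbs + 1)

theorem prod_prod_abs_add_one_le : ∏ i, ∏ j, (|I.A i j| + 1) ≤ 2 ^ I.matrixLength := by
  rw [matrixLength, ← Finset.prod_pow_eq_pow_sum]
  refine Finset.prod_le_prod (fun i _ => Finset.prod_nonneg fun j _ => by positivity) fun i _ => ?_
  rw [← Finset.prod_pow_eq_pow_sum]
  refine Finset.prod_le_prod (fun j _ => by positivity) fun j _ => ?_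
  rw [Int.abs_eq_natAbs]
  exact_mod_cast Nat.le_pow_clog one_lt_two ((I.A i j).natAbs + 1)

theorem abs_det_submatrix_le_two_pow (g : Fin m → Fin n) :
    |(I.toLO.A.submatrix id g).det| ≤ 2 ^ I.matrixLength := by
  rw [toLO, det_submatrix_map_intCast]
  exact_mod_cast (abs_det_submatrix_le_prod_prod I.A g).trans I.prod_prod_abs_add_one_le

theorem sum_abs_le_two_pow : ∑ i, ∑ j, |I.toLO.A i j| ≤ 2 ^ I.matrixLength := by
  have hsum : ∑ i, ∑ j, |I.A i j| ≤ ∏ i, ∏ j, (|I.A i j| + 1) := by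
    have hle := sum_le_prod_add_one (f := fun q : Fin m × Fin n => |I.A q.1 q.2|)
      fun _ => abs_nonneg _
    rwa [Fintype.sum_prod_type, Fintype.prod_prod_type] at hle
  simp only [toLO, Matrix.map_apply]
  exact_mod_cast hsum.trans I.prod_prod_abs_add_one_le

variable {I}

theorem matrixLength_pos (hA : I.toLO.A.rank = m) (hm : m ≠ 0) : 0 < I.matrixLength := by
  refine Nat.pos_of_ne_zero fun h => hm ?_
  have hclog : ∀ i j, Nat.clog 2 ((I.A i j).natAbs + 1) = 0 := fun i j =>
    Finset.sum_eq_zero_iff.mp (Finset.sum_eq_zero_iff.mp h i (Finset.mem_univ i)) j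
      (Finset.mem_univ j)
  have hzero : I.toLO.A = 0 := by
    ext i j
    have hle := Nat.le_pow_clog one_lt_two ((I.A i j).natAbs + 1)
    rw [hclog, pow_zero] at hle
    exact Int.cast_eq_zero.mpr (Int.natAbs_eq_zero.mp (by omega))
  rw [← hA, hzero, Matrix.rank_zero]

theorem two_mul_add_matrixLength_le_inputLength {y₀ : Fin m → ℝ} {s₀ : Fin n → ℝ}
    (hdual : I.toLO.Aᵀ *ᵥ y₀ + s₀ = I.toLO.c) (hs₀ : ∀ i, 0 < s₀ i) :
    2 * n + I.matrixLength ≤ I.inputLength := by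
  rcases Nat.eq_zero_or_pos m with rfl | hm
  · have hc : ∀ j, 1 ≤ Nat.clog 2 ((I.c j).natAbs + 1) := fun j => by
      have hpos : (0 : ℝ) < I.c j := by
        have hj := congrFun hdual j
        rw [LO.transpose_mulVec_eq_zero_of_rows_eq_zero, zero_add] at hj
        exact (hs₀ j).trans_eq hj
      have hne : I.c j ≠ 0 := by exact_mod_cast hpos.ne'
      exact Nat.clog_pos one_lt_two (by omega)
    have hsum := Finset.card_nsmul_le_sum Finset.univ _ 1 fun j _ => hc j
    rw [Finset.card_univ, Fintype.card_fin, smul_eq_mul, mul_one] at hsum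
    rw [matrixLength, Finset.univ_eq_empty, Finset.sum_empty]
    unfold inputLength
    omega
  · have hmn : n ≤ m * n := Nat.le_mul_of_pos_left n hm
    unfold inputLength matrixLength
    omega

theorem two_mul_add_two_le_inputLength (hA : I.toLO.A.rank = m) (hm : m ≠ 0) :
    2 * n + 2 ≤ I.inputLength := by
  have hmn : n ≤ m * n := Nat.le_mul_of_pos_left n (Nat.pos_of_ne_zero hm)
  have hpos := matrixLength_pos hA hm
  rw [matrixLength] at hpos
  unfold inputLength
  omega

theorem minor_bound_le {ℓ : ℕ} (hℓ : 2 * n + I.matrixLength ≤ ℓ) :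
    4 * (n : ℝ) ^ 2 * 2 ^ I.matrixLength ≤ 2 ^ ℓ := by
  calc 4 * (n : ℝ) ^ 2 * 2 ^ I.matrixLength ≤ 2 ^ (2 * n) * 2 ^ I.matrixLength := by
        gcongr
        exact four_mul_sq_le_two_pow n
    _ = 2 ^ (2 * n + I.matrixLength) := (pow_add _ _ _).symm
    _ ≤ 2 ^ ℓ := pow_le_pow_right₀ one_le_two hℓ

end IntLO

/-! ### Runs on integer data -/

theorem LO.IsShortStepRun.mem_approxOptimalSet {m n : ℕ} {P : LO m n} {Λ H θ ε : ℝ}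
    {y : ℕ → Fin m → ℝ} {s : ℕ → Fin n → ℝ} {μ : ℕ → ℝ} {dsHat : ℕ → Fin n → ℝ}
    {dy : ℕ → Fin m → ℝ} {K : ℕ} (h : P.IsShortStepRun Λ H θ ε y s μ dsHat dy K)
    (hend : μ K ≤ (Λ ^ 2)⁻¹) :
    (P.primalEstimate (s K) (μ K), y K, s K) ∈
      (P.perturb (P.perturbation s dsHat dy K)).approxOptimalSet (3 / 2 * (Λ ^ 2)⁻¹) := by
  refine ⟨(h.mem_interiorSet le_rfl).1, ?_⟩
  have hn : (0 : ℝ) < n := by exact_mod_cast h.n_pos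
  rw [div_le_iff₀ hn]
  calc P.primalEstimate (s K) (μ K) ⬝ᵥ s K ≤ ∑ _i : Fin n, 3 / 2 * (Λ ^ 2)⁻¹ :=
        Finset.sum_le_sum fun i _ =>
          ((h.isCentered le_rfl).primalEstimate_mul_lt i).le.trans (by gcongr)
    _ = 3 / 2 * (Λ ^ 2)⁻¹ * n := by
        rw [Finset.sum_const, Finset.card_univ, Fintype.card_fin, nsmul_eq_mul, mul_comm]

theorem LO.IsShortStepRun.isNearlyOptimal {m n : ℕ} {I : IntLO m n} {Λ H θ ε D : ℝ}
    {y : ℕ → Fin m → ℝ} {s : ℕ → Fin n → ℝ} {μ : ℕ → ℝ} {dsHat : ℕ → Fin n → ℝ}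
    {dy : ℕ → Fin m → ℝ} {K : ℕ} (h : I.toLO.IsShortStepRun Λ H θ ε y s μ dsHat dy K)
    (hend : μ K ≤ (Λ ^ 2)⁻¹) (hdet : ∀ g : Fin m → Fin n, |(I.toLO.A.submatrix id g).det| ≤ D)
    (hD : 4 * n ^ 2 * D ≤ Λ) :
    ∃ y', I.IsNearlyOptimal Λ D (μ K) (I.toLO.primalEstimate (s K) (μ K)) y' (s K)
      (I.toLO.slackError s μ dsHat K) := by
  have hc := h.isCentered le_rfl
  have hΛ := h.Λ_pos
  have hH := h.H_pos
  obtain ⟨y', hy'⟩ := h.exists_transpose_mulVec_add_eq le_rfl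
  exact ⟨y', {
    n_pos := h.n_pos
    rank_eq := h.rank_eq
    exists_dual_pos := ⟨y 0, s 0, h.dual_start, h.centered_start.pos⟩
    exists_strictly_complementary :=
      h.centered_start.exists_strictly_complementary h.rank_eq h.n_pos h.dual_start
    mulVec_eq := LO.mulVec_primalEstimate h.rank_eq hc.pos hc.mu_pos.ne'
    dual_eq := hy'
    primal_pos := hc.primalEstimate_pos
    slack_pos := hc.pos
    mu_pos := hc.mu_pos
    half_mu_lt := hc.half_mu_lt
    gap_le := fun _ hp => h.optimality_gap_le hp
    four_le := h.four_le
    mu_mul_le := by rwa [← le_div_iff₀ (by positivity), one_div]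
    abs_error_le := fun i => (h.abs_slackError_le le_rfl i).trans <| by
      rw [div_le_iff₀ (by positivity), mul_comm H, inv_mul_cancel_left₀ (by positivity)]
      exact h.start_le i
    abs_det_le := hdet
    minor_bound_le := hD }⟩

theorem LO.IsExecution.iteration_count_le {m n : ℕ} {P : LO m n} {κ θ ε ℓ : ℝ} {y : ℕ → Fin m → ℝ}
    {s : ℕ → Fin n → ℝ} {μ : ℕ → ℝ} {dsHat : ℕ → Fin n → ℝ} {dy : ℕ → Fin m → ℝ} {K : ℕ}
    (h : P.IsExecution (2 ^ (-(2 * ℓ))) θ ε y s μ dsHat dy K) (hκ : 1 ≤ κ) (hn : 0 < n)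
    (hℓ : 0 ≤ ℓ) (hμ₀ : 0 < μ 0) (hμH : μ 0 ≤ 2 ^ (κ * ℓ)) (hθ : 1 / (4 * κ * √n) ≤ θ)
    (hθ₁ : θ ≤ 1) : K ≤ 1 + 14 / 5 * (κ * (κ + 2)) * (√n * ℓ) :=
  count_le_of_two_rpow_lt_pow_mul hκ (by positivity) hℓ hμ₀ hμH hθ hθ₁ fun k hk => by
    rw [← h.mu_eq hk.le]
    exact h.guard k hk

theorem two_rpow_neg_two_mul (ℓ : ℝ) : (2 : ℝ) ^ (-(2 * ℓ)) = ((2 ^ ℓ) ^ 2)⁻¹ := by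
  rw [Real.rpow_neg zero_le_two, mul_comm, Real.rpow_mul zero_le_two, Real.rpow_two]

theorem two_rpow_neg_mul_mul (κ t ℓ : ℝ) (a : ℕ) :
    (2 : ℝ) ^ (-(t * ℓ)) * ((2 ^ (κ * ℓ)) ^ 3 * (2 ^ ℓ) ^ a) = 2 ^ ((3 * κ + a - t) * ℓ) := by
  rw [← Real.rpow_mul_natCast zero_le_two, ← Real.rpow_mul_natCast zero_le_two,
    ← Real.rpow_add two_pos, ← Real.rpow_add two_pos]
  congr 1
  push_cast
  ring

theorem IntLO.isShortStepRun {m n : ℕ} {I : IntLO m n} {κ t θ : ℝ} {y : ℕ → Fin m → ℝ}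
    {s : ℕ → Fin n → ℝ} {μ : ℕ → ℝ} {dsHat : ℕ → Fin n → ℝ} {dy : ℕ → Fin m → ℝ} {K : ℕ}
    (hκ : 1 ≤ κ) (ht : 3 * κ + 6 ≤ t) (hn : 0 < n) (hA : I.toLO.A.rank = m) (hθ : 0 ≤ θ)
    (hθn : θ ≤ 1 / (4 * √n)) (hdual : I.toLO.Aᵀ *ᵥ y 0 + s 0 = I.toLO.c)
    (hs₀ : ∀ i, (2 : ℝ) ^ (-(κ * I.inputLength)) ≤ s 0 i ∧ s 0 i ≤ 2 ^ (κ * I.inputLength))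
    (hμ₀ : 0 < μ 0) (hμH : μ 0 ≤ 2 ^ (κ * I.inputLength))
    (hδ : I.toLO.proximity (s 0) (μ 0) < 1 / 2)
    (hK : K ≤ 1 + 14 / 5 * (κ * (κ + 2)) * (√n * I.inputLength))
    (h : I.toLO.IsExecution (2 ^ (-(2 * I.inputLength : ℝ))) θ (2 ^ (-(t * I.inputLength)))
      y s μ dsHat dy K) :
    I.toLO.IsShortStepRun (2 ^ (I.inputLength : ℝ)) (2 ^ (κ * I.inputLength)) θ
      (2 ^ (-(t * I.inputLength))) y s μ dsHat dy K := by
  have hpos : ∀ i, 0 < s 0 i := fun i => (by positivity : (0 : ℝ) < _).trans_le (hs₀ i).1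
  have hℓ := two_mul_add_matrixLength_le_inputLength hdual hpos
  have h2n : 2 * n ≤ I.inputLength := by omega
  have hΛ : (2 : ℝ) ^ I.matrixLength ≤ 2 ^ (I.inputLength : ℝ) := by
    rw [Real.rpow_natCast]
    exact pow_le_pow_right₀ one_le_two (by omega)
  have hΛH : (2 : ℝ) ^ (I.inputLength : ℝ) ≤ 2 ^ (κ * I.inputLength) :=
    Real.rpow_le_rpow_of_exponent_le one_le_two (le_mul_of_one_le_left (Nat.cast_nonneg _) hκ)
  have hH : (1 : ℝ) ≤ 2 ^ (κ * I.inputLength) := Real.one_le_rpow one_le_two (by positivity)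
  rw [two_rpow_neg_two_mul] at h
  exact { h with
    n_pos := hn
    rank_eq := hA
    dual_start := hdual
    centered_start := ⟨hpos, hμ₀, hδ⟩
    inv_le_start := fun i => (Real.rpow_neg zero_le_two _).symm.trans_le (hs₀ i).1
    start_le := fun i => (hs₀ i).2
    mu_start_le := hμH
    theta_nonneg := hθ
    theta_mul_sqrt_le := by
      rw [le_div_iff₀ (by positivity)] at hθn
      linarith
    four_le := by
      rw [Real.rpow_natCast]
      calc (4 : ℝ) = 2 ^ 2 := by norm_num
        _ ≤ 2 ^ I.inputLength := pow_le_pow_right₀ one_le_two (by omega)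
    le_bound := hΛH
    eps_nonneg := by positivity
    eps_mul_le := by
      rw [two_rpow_neg_mul_mul]
      exact Real.rpow_le_one_of_one_le_of_nonpos one_le_two
        (mul_nonpos_of_nonpos_of_nonneg (by push_cast; linarith) (Nat.cast_nonneg _))
    sum_abs_le := (I.sum_abs_le_two_pow.trans (hΛ.trans hΛH)).trans (le_self_pow₀ hH two_ne_zero)
    passes_mul_le := mul_growthFactor_sq_le_of_le hn h2n (two_mul_add_two_le_inputLength hA) hκ hK
    growthFactor_le := by
      rw [Real.rpow_natCast]
      exact thirteen_mul_growthFactor_le hn h2n (two_mul_add_two_le_inputLength hA) }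

theorem mainTheorem1 (κ : ℝ) (hκ : 1 ≤ κ) :
    ∃ C : ℝ, 0 < C ∧
      ∀ t : ℝ, 3 * κ + 6 ≤ t →
      ∀ (m n : ℕ), 0 < n →
      ∀ I : IntLO m n, I.toLO.A.rank = m →
      ∀ (θ : ℝ), 1 / (4 * κ * √n) ≤ θ → θ ≤ 1 / (4 * √n) →
      ∀ (y : ℕ → Fin m → ℝ) (s : ℕ → Fin n → ℝ) (μ : ℕ → ℝ)
        (dsHat : ℕ → Fin n → ℝ) (dy : ℕ → Fin m → ℝ) (K : ℕ),
        I.toLO.Aᵀ *ᵥ y 0 + s 0 = I.toLO.c →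
        (∀ i, (2 : ℝ) ^ (-(κ * I.inputLength)) ≤ s 0 i ∧ s 0 i ≤ (2 : ℝ) ^ (κ * I.inputLength)) →
        0 < μ 0 → μ 0 ≤ (2 : ℝ) ^ (κ * I.inputLength) →
        I.toLO.proximity (s 0) (μ 0) < 1 / 2 →
        I.toLO.IsExecution ((2 : ℝ) ^ (-(2 * I.inputLength : ℝ))) θ
          ((2 : ℝ) ^ (-(t * I.inputLength))) y s μ dsHat dy K →
        (K : ℝ) ≤ C * √n * I.inputLength ∧
        (∀ k ≤ K,
          IsUnit (I.toLO.newtonMatrix (s k)).det ∧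
          I.toLO.proximity (s k) (μ k) < 1 / 2 ∧
          (I.toLO.primalEstimate (s k) (μ k), y k, s k) ∈
            (I.toLO.perturb (I.toLO.perturbation s dsHat dy k)).interiorSet ∧
          l2norm (I.toLO.perturbation s dsHat dy k) ≤
            (2 : ℝ) ^ ((3 * κ + 2 - t) * I.inputLength)) ∧
        (μ K ≤ (2 : ℝ) ^ (-(2 * I.inputLength : ℝ)) →
          (I.toLO.primalEstimate (s K) (μ K), y K, s K) ∈
            (I.toLO.perturb (I.toLO.perturbation s dsHat dy K)).approxOptimalSet
              (3 / 2 * (2 : ℝ) ^ (-(2 * I.inputLength : ℝ))) ∧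
          {i | s K i < (2 : ℝ) ^ (-(I.inputLength : ℝ))} = I.toLO.partitionB ∧
          {i | I.toLO.primalEstimate (s K) (μ K) i < (2 : ℝ) ^ (-(I.inputLength : ℝ))}
            = I.toLO.partitionN ∧
          (∃ p, I.toLO.IsRounding ((2 : ℝ) ^ (-(I.inputLength : ℝ)))
            (I.toLO.primalEstimate (s K) (μ K)) (s K) p) ∧
          ∀ p, I.toLO.IsRounding ((2 : ℝ) ^ (-(I.inputLength : ℝ)))
            (I.toLO.primalEstimate (s K) (μ K)) (s K) p → p ∈ I.toLO.optimalSet) := by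
  refine ⟨1 + 14 / 5 * (κ * (κ + 2)), by positivity, ?_⟩
  intro t ht m n hn I hA θ hθl hθu y s μ dsHat dy K hdual hs₀ hμ₀ hμH hδ hexec
  have hsqrt : 1 ≤ √(n : ℝ) := Real.one_le_sqrt.mpr (by exact_mod_cast hn)
  have hθ₀ : 0 ≤ θ := le_trans (by positivity) hθl
  have hθ₁ : θ ≤ 1 := hθu.trans ((div_le_one₀ (by positivity)).mpr (by linarith))
  have hpos : ∀ i, 0 < s 0 i := fun i => (by positivity : (0 : ℝ) < _).trans_le (hs₀ i).1
  have hℓ := IntLO.two_mul_add_matrixLength_le_inputLength hdual hpos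
  have hℓ₁ : 1 ≤ I.inputLength := by omega
  have hcount := hexec.iteration_count_le hκ hn (Nat.cast_nonneg _) hμ₀ hμH hθl hθ₁
  have hrun := IntLO.isShortStepRun hκ ht hn hA hθ₀ hθu hdual hs₀ hμ₀ hμH hδ hcount hexec
  refine ⟨hcount.trans ?_, fun k hk => ?_, fun hend => ?_⟩
  · have hone : 1 ≤ √(n : ℝ) * I.inputLength :=
      one_le_mul_of_one_le_of_one_le hsqrt (by exact_mod_cast hℓ₁)
    linarith
  · have hc := hrun.isCentered hk
    refine ⟨LO.isUnit_det_newtonMatrix _ hA hc.pos, hc.proximity_lt, hrun.mem_interiorSet hk, ?_⟩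
    exact (hrun.l2norm_perturbation_le hk).trans_eq (two_rpow_neg_mul_mul κ t I.inputLength 2)
  · rw [two_rpow_neg_two_mul] at hend ⊢
    rw [Real.rpow_neg zero_le_two]
    obtain ⟨y', hopt⟩ := hrun.isNearlyOptimal hend I.abs_det_submatrix_le_two_pow
      (by rw [Real.rpow_natCast]; exact IntLO.minor_bound_le hℓ)
    exact ⟨hrun.mem_approxOptimalSet hend, Set.ext fun _ => hopt.slack_lt_inv_iff,
      Set.ext fun _ => hopt.primal_lt_inv_iff, hopt.exists_isRounding,
      fun _ => hopt.mem_optimalSet_of_isRounding⟩
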